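/- Let $O\subset\mathbb R^2$ be the regular octagon with center at the origin, sides of unit length and two horizontal sides, with vertices $O_1,\dots,O_8$ in clockwise order, $\overline{O_1O_2}$ being the top horizontal side. Glue opposite sides by translation, and label the pairs of opposite sides $\overline{O_1O_2},\overline{O_5O_6}$ by $A$; $\overline{O_2O_3},\overline{O_6O_7}$ by $B$; $\overline{O_3O_4},\overline{O_7O_8}$ by $C$; $\overline{O_4O_5},\overline{O_8O_1}$ by $D$. A bi-infinite linear trajectory moves in $O$ with constant velocity in some direction $\theta$; when it hits a side it re-enters at the corresponding point of the opposite side, and it never hits a vertex, in the past or in the future. Its cutting sequence is the word in $\{A,B,C,D\}^{\mathbb Z}$ of labels of the sides that it crosses as time increases (a word is indexed up to a shift; all indexings are allowed). Put $\pi_0=\mathrm{id}$, $\pi_1=(AD)(BC)$, $\pi_2=(ABCD)$, $\pi_3=(AC)$, $\pi_4=(AC)(BD)$, $\pi_5=(AB)(CD)$, $\pi_6=(ADCB)$, $\pi_7=(BD)$, acting on words letter by letter. Let $\mathscr D_0$ be the directed graph on $\{A,B,C,D\}$ with edges $AD,DA,DB,BD,BC,CB,CC$, and for $0\le i\le 7$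 let $\mathscr D_i$ be the graph with an edge $LL'$ if and only if $\pi_i(L)\pi_i(L')$ is an edge of $\mathscr D_0$. A word is admissible in diagram $i$ if it is an infinite path on $\mathscr D_i$, and admissible if it is so for some $i$. A letter of a word is $L'$-sandwiched if it is both preceded and followed by $L'$, and sandwiched if it is $L'$-sandwiched for some $L'$. The derived sequence $w'$ of $w$ is obtained by keeping only the sandwiched letters. A word $w$ is derivable if $w$ and $w'$ are admissible, and infinitely derivable if $w$ and all its iterated derived sequences are derivable. A derivable word $w$ is coherent with respect to $(i,j)$, where $i,j\in\{0,\dots,7\}$, if $w$ is admissible in diagram $i$; $j\ne0$ and $(\pi_i\cdot w)'$ is admissible in diagram $j$; and all the sandwiched letters that occur in $\pi_i\cdot w$ belong to the group $G_k$ with $k=\lfloor j/2\rfloor$, where, writing $L'|L$ for "$L'$-sandwiched $L$", $$G_0=\{D|A,\,C|B,\,B|C,\,A|D\},\quad G_1=\{D|A,\,C|B,\,B|C,\,B|D\},$$ $$G_2=\{D|A,\,C|B,\,C|C,\,B|D\},\quad G_3=\{D|A,\,D|B,\,C|C,\,B|D\}.$$ Let $S^*$ be the set of sequences $(s_k)_{k\ge0}$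 in $\{0,\dots,7\}$ such that $s_k=0$ implies $k=0$. A word $w$ is infinitely coherent if it is infinitely derivable and there is $s\in S^*$ such that, with $w_0:=w$ and $w_{k+1}:=(\pi_{s_k}\cdot w_k)'$, the word $w_k$ is coherent with respect to $(s_k,s_{k+1})$ for every $k\ge0$. **Theorem.** In $\{A,B,C,D\}^{\mathbb Z}$ with the product of the discrete topologies, the closure of the set of cutting sequences of bi-infinite linear trajectories in the octagon $O$ with opposite sides glued is exactly the set of infinitely coherent words. -/

import Mathlib

namespace OctagonCutting

/-- The alphabet labelling the four pairs of opposite sides of the octagon. -/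
inductive Letter
  | A
  | B
  | C
  | D

/-- The alphabet carries the discrete topology; words carry the product topology. -/
instance : TopologicalSpace Letter := ⊥

instance : DiscreteTopology Letter := ⟨rfl⟩

/-- Bi-infinite words. -/
abbrev Word := ℤ → Letter

open Letter

/-! ### The octagon, its linear trajectories and their cutting sequences -/

/-- Half of the width of the regular octagon with sides of unit length. -/
noncomputable def halfWidth : ℝ := (1 + √2) / 2

/-- The vertices of the regular octagon centred at the origin, with sides of unit length and two
horizontal sides, listed clockwise; `vertex 0` and `vertex 1` bound the horizontal top side. -/
noncomputable def vertex : Fin 8 → ℝ × ℝ :=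
  ![(-(1 / 2), halfWidth), (1 / 2, halfWidth),
    (halfWidth, 1 / 2), (halfWidth, -(1 / 2)),
    (1 / 2, -halfWidth), (-(1 / 2), -halfWidth),
    (-halfWidth, -(1 / 2)), (-halfWidth, 1 / 2)]

/-- The closed octagon. -/
noncomputable def octagon : Set (ℝ × ℝ) := convexHull ℝ (Set.range vertex)

/-- The side from `vertex k` to `vertex (k + 1)` (indices modulo 8), without its end points. -/
noncomputable def openSide (k : Fin 8) : Set (ℝ × ℝ) := openSegment ℝ (vertex k) (vertex (k + 1))

/-- The labels of the sides; opposite sides have the same label. -/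
def sideLabel : Fin 8 → Letter := ![A, B, C, D, A, B, C, D]

/-- The vector of the translation that glues the side `k` to the opposite side `k + 4`: it carries
`vertex k` to `vertex (k + 5)` and `vertex (k + 1)` to `vertex (k + 4)`. -/
noncomputable def glueVector (k : Fin 8) : ℝ × ℝ := vertex (k + 5) - vertex k

/-- The unit vector that makes the angle `θ` with the horizontal. -/
noncomputable def direction (θ : ℝ) : ℝ × ℝ := (Real.cos θ, Real.sin θ)

/-- A bi-infinite linear trajectory in the octagon with opposite sides glued, which never hits a
vertex, given by its successive chords. The `n`-th chord starts on the boundary at the point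
`entry n`, moves with the constant velocity `direction θ` for a time `time n > 0` through the
interior of the octagon, and ends at a point in the relative interior of the side `side n`. There
the trajectory re-enters the octagon at the corresponding point of the opposite side. -/
structure LinearTrajectory where
  θ : ℝ
  entry : ℤ → ℝ × ℝ
  time : ℤ → ℝ
  side : ℤ → Fin 8
  time_pos : ∀ n, 0 < time n
  exit_mem : ∀ n, entry n + time n • direction θ ∈ openSide (side n)
  chord_subset : ∀ n,
    openSegment ℝ (entry n) (entry n + time n • direction θ) ⊆ interior octagon
  entry_succ : ∀ n, entry (n + 1) = entry n + time n • direction θ + glueVector (side n)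

/-- The cutting sequence: the labels of the pairs of sides crossed as time increases. -/
def LinearTrajectory.cuttingSequence (τ : LinearTrajectory) : Word :=
  fun n => sideLabel (τ.side n)

/-! ### Permutations, transition diagrams and admissibility -/

/-- The map `A ↦ a, B ↦ b, C ↦ c, D ↦ d`. -/
def table (a b c d : Letter) : Letter → Letter
  | A => a
  | B => b
  | C => c
  | D => d

/-- The permutations `π_0 = id`, `π_1 = (AD)(BC)`, `π_2 = (ABCD)`, `π_3 = (AC)`,
`π_4 = (AC)(BD)`, `π_5 = (AB)(CD)`, `π_6 = (ADCB)`, `π_7 = (BD)`, induced on the labels by the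
isometry of the octagon that carries the sector of directions `[iπ/8, (i+1)π/8]` to `[0, π/8]`. -/
def perm : Fin 8 → Letter → Letter :=
  ![table A B C D, table D C B A, table B C D A, table C B A D,
    table C D A B, table B A D C, table D A B C, table A D C B]

/-- The action of a permutation on a word, letter by letter. -/
def relabel (i : Fin 8) (w : Word) : Word := fun n => perm i (w n)

/-- The edges of the transition diagram of the sector `[0, π/8]`. -/
inductive Edge0 : Letter → Letter → Prop
  | AD : Edge0 A D
  | DA : Edge0 D A
  | DB : Edge0 D B
  | BD : Edge0 B D
  | BC : Edge0 B C
  | CB : Edge0 C B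
  | CC : Edge0 C C

/-- The edges of the transition diagram of the sector `[iπ/8, (i+1)π/8]`: this diagram is carried
to that of the sector `[0, π/8]` by relabelling its vertices by `perm i`. -/
def Edge (i : Fin 8) (L L' : Letter) : Prop := Edge0 (perm i L) (perm i L')

/-- The word `w` is an infinite path on the `i`-th transition diagram. -/
def AdmissibleIn (i : Fin 8) (w : Word) : Prop := ∀ n, Edge i (w n) (w (n + 1))

def Admissible (w : Word) : Prop := ∃ i, AdmissibleIn i w

/-! ### Derivation -/

/-- The letter of `w` at position `n` is preceded and followed by the same letter. -/
def Sandwiched (w : Word) (n : ℤ) : Prop := w (n - 1) = w (n + 1)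

/-- `v` is the derived sequence of `w`: it lists, in order, exactly the sandwiched letters of `w`.
The origin of the enumeration `e` is free, so `v` is determined up to a shift; all the properties
of words below are shift invariant. -/
def IsDerived (w v : Word) : Prop :=
  ∃ e : ℤ → ℤ, StrictMono e ∧ Set.range e = {n | Sandwiched w n} ∧ ∀ n, v n = w (e n)

def Derivable (w : Word) : Prop := Admissible w ∧ ∃ v, IsDerived w v ∧ Admissible v

/-- The word and all its iterated derived sequences `v n` are derivable. -/
def InfinitelyDerivable (w : Word) : Prop :=
  ∃ v : ℕ → Word, v 0 = w ∧ (∀ n, IsDerived (v n) (v (n + 1))) ∧ ∀ n, Derivable (v n)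

/-! ### Coherence -/

/-- The group `G_k` consists of the `group k L`-sandwiched `L`, for the four letters `L`. -/
def group : Fin 4 → Letter → Letter :=
  ![table D C B A, table D C B B, table D C C B, table D D C B]

/-- All the sandwiched letters which occur in `w` belong to the group `G_k`. -/
def SandwichedInGroup (k : Fin 4) (w : Word) : Prop :=
  ∀ n, Sandwiched w n → w (n - 1) = group k (w n)

/-- The word `w` is coherent with respect to the pair `(i, j)`. -/
def CoherentWith (i j : Fin 8) (w : Word) : Prop :=
  Derivable w ∧
  AdmissibleIn i w ∧
  ∃ k : Fin 4, SandwichedInGroup k (relabel i w) ∧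
    (j ≠ 0 ∧ ∃ v, IsDerived (relabel i w) v ∧ AdmissibleIn j v) ∧
    (k : ℕ) = (j : ℕ) / 2

/-- The set `S*` of sequences in `{0, …, 7}` whose entries of positive index do not vanish. -/
def SStar : Set (ℕ → Fin 8) := {s | ∀ k, s k = 0 → k = 0}

/-- `W k` is the `k`-th renormalized word of `w` with respect to `s`. -/
def IsRenormalizedSequence (s : ℕ → Fin 8) (w : Word) (W : ℕ → Word) : Prop :=
  W 0 = w ∧ ∀ k, IsDerived (relabel (s k) (W k)) (W (k + 1))

def InfinitelyCoherentWith (s : ℕ → Fin 8) (w : Word) : Prop :=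
  InfinitelyDerivable w ∧
  ∃ W : ℕ → Word, IsRenormalizedSequence s w W ∧ ∀ k, CoherentWith (s k) (s (k + 1)) (W k)

def InfinitelyCoherent (w : Word) : Prop := ∃ s ∈ SStar, InfinitelyCoherentWith s w

end OctagonCutting

namespace OctagonCutting

open Letter

/-! ### Codings of words by heights -/

/-! A trajectory is encoded by real numbers. If `t n` is twice the height, across the direction, of
the `n`-th crossing point above the midpoint of its side, then `|t n|` is less than the projected
length of the side, and `t (n + 1) - t n` depends only on the two labels. Conversely, such heights
determine the chords. Hence the cutting sequences are exactly the codings `IsCoding` over all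
directions (`range_cuttingSequence`), and the isometries of the octagon reduce them to the sector
`[0, π/8]`.

The engine is a renormalization of that sector: `(c, a) ↦ (-c + 2 * silver * a, a)` carries it to
`[π/8, π]`. Between two sandwiched letters an admissible path cannot backtrack, so it runs along a
piece of the fixed word `chain`, determined by the group and the two end letters. Along this piece
the height plus `chainHeight` is constant. The identity `center_renorm` then turns the heights at
the sandwiched letters, negated, into a coding for the renormalized direction (`IsCoding.derive`).
Conversely, `IsCoding.generate` fills in the pieces and recovers a coding for the original
direction.

Limits of cutting sequences are coherent because admissibility and the group condition are local and
derivation has bounded gaps: both pass to limits, and since there are finitely many sectors one of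
them serves the limit word. Iteration yields a tower (`exists_coherentTower`).

Conversely, let a tower be given. A window of its bottom word either has only sandwiched interior
letters, hence alternates between two letters and occurs in a periodic trajectory, or it is
determined by a strictly shorter window of the next word. Induction on the length
(`IsCoherentTower.exists_window`) realizes every window by a trajectory. -/

/-- `1 + √2`, the ratio of the width of the octagon to its side. -/
noncomputable def silver : ℝ := 1 + √2

/-- The scalar product of `(x, y)` with the outward normal of the side `0, 1, 2, 3` labelled `L`. -/
noncomputable def normalDot (x y : ℝ) : Letter → ℝ
  | A => y
  | B => √2 / 2 * (x + y)
  | C => x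
  | D => √2 / 2 * (x - y)

/-- The determinant of `(x, y)` and the outward normal of the side `0, 1, 2, 3` labelled `L`. -/
noncomputable def normalCross (x y : ℝ) : Letter → ℝ
  | A => x
  | B => √2 / 2 * (x - y)
  | C => -y
  | D => -(√2 / 2 * (x + y))

/-- Whether a trajectory with direction in `[kπ/4, (k+1)π/4]` leaves the octagon through the side
`0, 1, 2, 3` labelled `L` or through the opposite side. -/
def exitSign (k : Fin 4) : Letter → ℝ
  | A => 1
  | B => if k = 3 then -1 else 1
  | C => if k = 2 ∨ k = 3 then -1 else 1
  | D => if k = 0 then 1 else -1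

/-- The length of the projection of the sides labelled `L` along the direction `(x, y)`. -/
noncomputable def radius (k : Fin 4) (x y : ℝ) (L : Letter) : ℝ := exitSign k L * normalDot x y L

/-- Twice the height of the midpoint of the exit side labelled `L`. -/
noncomputable def center (k : Fin 4) (x y : ℝ) (L : Letter) : ℝ :=
  silver * (exitSign k L * normalCross x y L)

/-- The word `w` is the coding of a sequence of centred heights. -/
def IsCoding (r q : Letter → ℝ) (w : Word) : Prop :=
  ∃ t : ℤ → ℝ, ∀ n, |t n| < r (w n) ∧ t (n + 1) = t n - q (w n) - q (w (n + 1))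

theorem IsCoding.neg {r q : Letter → ℝ} {w : Word} (h : IsCoding r q w) :
    IsCoding r (fun L => -q L) w := by
  obtain ⟨t, ht⟩ := h
  refine ⟨fun n => -t n, fun n => ⟨by simpa using (ht n).1, ?_⟩⟩
  have := (ht n).2
  linarith

theorem IsCoding.smul {r q : Letter → ℝ} {w : Word} (h : IsCoding r q w) {l : ℝ} (hl : 0 < l) :
    IsCoding (fun L => l * r L) (fun L => l * q L) w := by
  obtain ⟨t, ht⟩ := h
  refine ⟨fun n => l * t n, fun n => ⟨?_, ?_⟩⟩
  · rw [abs_mul, abs_of_pos hl]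
    exact mul_lt_mul_of_pos_left (ht n).1 hl
  · simp only [(ht n).2]
    ring

theorem IsCoding.shift {r q : Letter → ℝ} {w : Word} (h : IsCoding r q w) (m : ℤ) :
    IsCoding r q (fun n => w (n + m)) := by
  obtain ⟨t, ht⟩ := h
  refine ⟨fun n => t (n + m), fun n => ⟨(ht _).1, ?_⟩⟩
  have := (ht (n + m)).2
  simpa only [add_right_comm] using this

/-- The vector of direction in the sector `j` which corresponds to `(c, a)` in the sector `0`:
the first coordinate. -/
noncomputable def sectorX (j : Fin 8) (c a : ℝ) : ℝ :=
  (![c, √2 / 2 * (c + a), √2 / 2 * (c - a), a, -a, √2 / 2 * (a - c), -(√2 / 2 * (c + a)), -c] :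
    Fin 8 → ℝ) j

/-- The second coordinate. -/
noncomputable def sectorY (j : Fin 8) (c a : ℝ) : ℝ :=
  (![a, √2 / 2 * (c - a), √2 / 2 * (c + a), c, c, √2 / 2 * (c + a), √2 / 2 * (c - a), a] :
    Fin 8 → ℝ) j

/-- The index of the quarter `[kπ/4, (k+1)π/4]` which contains the sector `j`. -/
def quarter : Fin 8 → Fin 4 := ![0, 0, 1, 1, 2, 2, 3, 3]

theorem quarter_val (j : Fin 8) : (quarter j : ℕ) = (j : ℕ) / 2 := by
  revert j; decide

theorem sqrt_two_mul_self : √2 * √2 = (2 : ℝ) := Real.mul_self_sqrt (by norm_num)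

theorem radius_sector (j : Fin 8) (c a : ℝ) (L : Letter) :
    radius (quarter j) (sectorX j c a) (sectorY j c a) L = radius 0 c a (perm j L) := by
  have h := sqrt_two_mul_self
  fin_cases j <;> cases L <;>
    simp [radius, quarter, sectorX, sectorY, perm, table, exitSign, normalDot] <;> grind

/-- Determinants change sign under the isometries that reverse orientation. The sign is harmless,
since negating all heights preserves codings (`IsCoding.neg`). -/
theorem center_sector (j : Fin 8) (c a : ℝ) :
    (∀ L, center (quarter j) (sectorX j c a) (sectorY j c a) L = center 0 c a (perm j L)) ∨
    (∀ L, center (quarter j) (sectorX j c a) (sectorY j c a) L = -center 0 c a (perm j L)) := by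
  have h := sqrt_two_mul_self
  have key : ∀ ε : ℝ, (∀ L, exitSign (quarter j) L * normalCross (sectorX j c a) (sectorY j c a) L
      = ε * (exitSign 0 (perm j L) * normalCross c a (perm j L))) →
      ∀ L, center (quarter j) (sectorX j c a) (sectorY j c a) L = ε * center 0 c a (perm j L) := by
    intro ε hL L
    simp only [center, hL]
    ring
  have h2 : (∀ L, exitSign (quarter j) L * normalCross (sectorX j c a) (sectorY j c a) L
      = 1 * (exitSign 0 (perm j L) * normalCross c a (perm j L))) ∨
      (∀ L, exitSign (quarter j) L * normalCross (sectorX j c a) (sectorY j c a) L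
      = -1 * (exitSign 0 (perm j L) * normalCross c a (perm j L))) := by
    fin_cases j <;> first
      | (left; intro L; cases L <;>
          simp [quarter, sectorX, sectorY, perm, table, exitSign, normalCross] <;> grind)
      | (right; intro L; cases L <;>
          simp [quarter, sectorX, sectorY, perm, table, exitSign, normalCross] <;> grind)
  rcases h2 with h2 | h2
  · left; simpa using key _ h2
  · right; simpa using key _ h2

/-- `(c, a)` is a nonzero vector with direction in the sector `[0, π/8]`. -/
structure BaseSector (c a : ℝ) : Prop where
  nonneg : 0 ≤ a
  le : silver * a ≤ c
  pos : 0 < c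

/-- The words coded in the sector `j`. -/
def InSector (j : Fin 8) : Set Word :=
  {w | ∃ c a, BaseSector c a ∧ IsCoding (radius 0 c a) (center 0 c a) (relabel j w)}

theorem isCoding_sector_iff (j : Fin 8) (c a : ℝ) (w : Word) :
    IsCoding (radius (quarter j) (sectorX j c a) (sectorY j c a))
      (center (quarter j) (sectorX j c a) (sectorY j c a)) w ↔
    IsCoding (radius 0 c a) (center 0 c a) (relabel j w) := by
  have h1 : radius (quarter j) (sectorX j c a) (sectorY j c a) = fun L => radius 0 c a (perm j L) :=
    funext (radius_sector j c a)
  rcases center_sector j c a with h2 | h2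
  · rw [h1, funext h2]
    rfl
  · rw [h1, funext h2]
    constructor
    · intro h
      have := h.neg
      simp only [neg_neg] at this
      exact this
    · intro h
      exact IsCoding.neg (q := fun L => center 0 c a (perm j L)) h

theorem InSector.shift {j : Fin 8} {w : Word} (h : w ∈ InSector j) (m : ℤ) :
    (fun n => w (n + m)) ∈ InSector j := by
  obtain ⟨c, a, h1, h2⟩ := h
  exact ⟨c, a, h1, h2.shift m⟩

theorem silver_bounds : 2.4 < silver ∧ silver < 2.5 := by
  have h := sqrt_two_mul_self
  have h0 : (0 : ℝ) ≤ √2 := Real.sqrt_nonneg 2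
  constructor <;> unfold silver <;> nlinarith

theorem sqrt_two_bounds : 1.4 < √2 ∧ √2 < (1.5 : ℝ) := by
  have := silver_bounds
  unfold silver at this
  constructor <;> linarith [this.1, this.2]

/-- The hypotheses describe the angles in `[π/8, π]`, where renormalized directions lie. The cases
are cut along the multiples of `π/8`, and each witness is the image of the vector under the isometry
to the base sector. -/
theorem exists_sector {x y : ℝ} (hy : 0 ≤ y) (hxy : x ≠ 0 ∨ y ≠ 0) (hx : x ≤ silver * y) :
    ∃ j : Fin 8, j ≠ 0 ∧ ∃ c a, BaseSector c a ∧ x = sectorX j c a ∧ y = sectorY j c a := by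
  have h := sqrt_two_mul_self
  obtain ⟨hs1, hs2⟩ := sqrt_two_bounds
  have hx' : x ≤ y + √2 * y := by unfold silver at hx; linarith
  have hpos : 0 < y ∨ (y = 0 ∧ x < 0) := by
    rcases hy.lt_or_eq with h1 | h1
    · exact Or.inl h1
    · right
      subst h1
      refine ⟨rfl, lt_of_le_of_ne (by simpa using hx) ?_⟩
      simpa using hxy
  -- With these identities, `√2 * x` and `√2 * y` can be treated as independent atoms by linear
  -- arithmetic.
  have e1 : √2 * (√2 * x) = 2 * x := by rw [← mul_assoc, h]
  have e2 : √2 * (√2 * y) = 2 * y := by rw [← mul_assoc, h]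
  have mk : ∀ (j : Fin 8) (c a : ℝ), 0 ≤ a → a + √2 * a ≤ c → 0 < c → x = sectorX j c a →
      y = sectorY j c a → j ≠ 0 →
      ∃ j : Fin 8, j ≠ 0 ∧ ∃ c a, BaseSector c a ∧ x = sectorX j c a ∧ y = sectorY j c a := by
    intro j c a h1 h2 h3 h4 h5 h6
    exact ⟨j, h6, c, a, ⟨h1, by unfold silver; linarith, h3⟩, h4, h5⟩
  have hmul : ∀ z : ℝ, 0 ≤ z → 0 ≤ √2 * z := fun z hz => by positivity
  have hmul' : ∀ z : ℝ, 0 < z → 0 < √2 * z := fun z hz => by positivity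
  by_cases h1 : y ≤ x
  · have h0 : 0 < y := by rcases hpos with h | h <;> linarith
    have := hmul (x - y) (by linarith)
    have := hmul' (x + y) (by linarith)
    refine mk 1 (√2 / 2 * (x + y)) (√2 / 2 * (x - y)) ?_ ?_ ?_ ?_ ?_ (by decide) <;>
      (try simp only [sectorX, sectorY, Fin.isValue, Matrix.cons_val]) <;> linarith
  push Not at h1
  by_cases h2 : y ≤ x + √2 * x
  · have h0 : 0 < x := by
      by_contra hx0
      have := hmul (-x) (by linarith)
      linarith
    have := hmul (y - x) (by linarith)
    have := hmul' (x + y) (by linarith)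
    refine mk 2 (√2 / 2 * (x + y)) (√2 / 2 * (y - x)) ?_ ?_ ?_ ?_ ?_ (by decide) <;>
      (try simp only [sectorX, sectorY, Fin.isValue, Matrix.cons_val]) <;> linarith
  push Not at h2
  by_cases h3 : 0 ≤ x
  · refine mk 3 y x ?_ ?_ ?_ ?_ ?_ (by decide) <;>
      (try simp only [sectorX, sectorY, Fin.isValue, Matrix.cons_val]) <;> linarith
  push Not at h3
  have h3' := hmul' (-x) (by linarith)
  by_cases h4 : -(x + √2 * x) ≤ y
  · refine mk 4 y (-x) ?_ ?_ ?_ ?_ ?_ (by decide) <;>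
      (try simp only [sectorX, sectorY, Fin.isValue, Matrix.cons_val]) <;> linarith
  push Not at h4
  by_cases h5 : -x ≤ y
  · have := hmul (x + y) (by linarith)
    have := hmul' (y - x) (by linarith)
    refine mk 5 (√2 / 2 * (y - x)) (√2 / 2 * (x + y)) ?_ ?_ ?_ ?_ ?_ (by decide) <;>
      (try simp only [sectorX, sectorY, Fin.isValue, Matrix.cons_val]) <;> linarith
  push Not at h5
  by_cases h6 : -x ≤ y + √2 * y
  · have := hmul (-x - y) (by linarith)
    have := hmul' (y - x) (by linarith)
    refine mk 6 (√2 / 2 * (y - x)) (√2 / 2 * (-x - y)) ?_ ?_ ?_ ?_ ?_ (by decide) <;>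
      (try simp only [sectorX, sectorY, Fin.isValue, Matrix.cons_val]) <;> linarith
  push Not at h6
  refine mk 7 (-x) y ?_ ?_ ?_ ?_ ?_ (by decide) <;>
      (try simp only [sectorX, sectorY, Fin.isValue, Matrix.cons_val]) <;> linarith

/-- For `j ≠ 0` these are the inequalities needed for the renormalization to bring the direction
back into the base sector. -/
theorem BaseSector.sector_bounds {c a : ℝ} (h : BaseSector c a) (j : Fin 8) :
    0 ≤ sectorY j c a ∧ (j ≠ 0 → sectorX j c a ≤ silver * sectorY j c a ∧
      0 < -sectorX j c a + 2 * silver * sectorY j c a) := by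
  obtain ⟨h1, h2, h3⟩ := h
  have hs := sqrt_two_mul_self
  have h0 := sqrt_two_bounds
  unfold silver at *
  have hmul : ∀ z : ℝ, 0 ≤ z → 0 ≤ √2 * z := fun z hz => by positivity
  have hmul' : ∀ z : ℝ, 0 < z → 0 < √2 * z := fun z hz => by positivity
  have e1 : √2 * (√2 * c) = 2 * c := by rw [← mul_assoc, hs]
  have e2 : √2 * (√2 * a) = 2 * a := by rw [← mul_assoc, hs]
  have h4 := hmul a h1
  have h5 := hmul' c h3
  have h6 := hmul (c - a) (by linarith)
  have h7 := hmul (c - a - √2 * a) (by linarith)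
  fin_cases j <;> simp [sectorX, sectorY] <;> (try constructor) <;> (try constructor) <;> linarith

theorem radius_base_nonneg {c a : ℝ} (h : BaseSector c a) (L : Letter) : 0 ≤ radius 0 c a L := by
  obtain ⟨h1, h2, h3⟩ := h
  have hs := silver_bounds
  have : a ≤ c := by nlinarith
  cases L <;> simp [radius, exitSign, normalDot] <;> first | positivity | linarith

theorem radius_sector_nonneg {c a : ℝ} (h : BaseSector c a) (j : Fin 8) (L : Letter) :
    0 ≤ radius (quarter j) (sectorX j c a) (sectorY j c a) L := by
  rw [radius_sector]
  exact radius_base_nonneg h _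

/-! ### The unfolded transition diagram -/

/-- The longest path without backtracking in the transition diagram of the sector `[0, π/8]`. -/
def chain : ℕ → Letter
  | 0 => A
  | 1 => D
  | 2 => B
  | 3 => C
  | 4 => C
  | 5 => B
  | 6 => D
  | _ => A

/-- The index in `chain` of the edge from `L` to `group k L`. -/
def startIndex : Fin 4 → Letter → ℕ
  | _, A => 0
  | 0, B => 2
  | 0, C => 4
  | 0, D => 6
  | 1, B => 2
  | 1, C => 4
  | 1, D => 1
  | 2, B => 2
  | 2, C => 3
  | 2, D => 1
  | 3, B => 5
  | 3, C => 3
  | 3, D => 1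

theorem startIndex_le (k : Fin 4) (L : Letter) : startIndex k L ≤ 6 := by
  fin_cases k <;> cases L <;> decide

theorem chain_startIndex (k : Fin 4) (L : Letter) : chain (startIndex k L) = L := by
  fin_cases k <;> cases L <;> rfl

theorem chain_startIndex_succ (k : Fin 4) (L : Letter) :
    chain (startIndex k L + 1) = group k L := by
  fin_cases k <;> cases L <;> rfl

theorem chain_reflect {j : ℕ} (hj : j ≤ 7) : chain (7 - j) = chain j := by
  interval_cases j <;> rfl

theorem chain_ne {j : ℕ} (hj : 1 ≤ j) (hj' : j ≤ 6) : chain (j - 1) ≠ chain (j + 1) := by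
  interval_cases j <;> simp [chain]

/-- The index in `chain` of an edge. -/
def edgeIndex : Letter → Letter → ℕ
  | A, D => 0
  | D, B => 1
  | B, C => 2
  | C, C => 3
  | C, B => 4
  | B, D => 5
  | D, A => 6
  | _, _ => 7

theorem Edge0.edgeIndex_le {L M : Letter} (h : Edge0 L M) : edgeIndex L M ≤ 6 := by
  cases h <;> decide

theorem Edge0.chain_edgeIndex {L M : Letter} (h : Edge0 L M) :
    chain (edgeIndex L M) = L ∧ chain (edgeIndex L M + 1) = M := by
  cases h <;> exact ⟨rfl, rfl⟩

theorem Edge0.symm {L M : Letter} (h : Edge0 L M) : Edge0 M L := by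
  cases h <;> constructor

theorem Edge0.edgeIndex_swap {L M : Letter} (h : Edge0 L M) :
    edgeIndex M L = 6 - edgeIndex L M := by
  cases h <;> rfl

/-- Every vertex of the diagram has at most two neighbours, so a path that does not backtrack has a
forced continuation. Positions are tracked by edges because each letter occurs twice in `chain`. -/
theorem Edge0.edgeIndex_succ {L M N : Letter} (h : Edge0 L M) (h' : Edge0 M N) (hne : L ≠ N) :
    edgeIndex M N = edgeIndex L M + 1 := by
  cases h <;> cases h' <;> first | rfl | exact absurd rfl hne

theorem edgeIndex_group {k : Fin 4} {L : Letter} (h : Edge0 L (group k L)) :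
    edgeIndex L (group k L) = startIndex k L := by
  revert h
  fin_cases k <;> cases L <;> intro h <;> rfl

/-! ### Renormalization of the heights -/

/-- The change of coordinates which carries the sector `[0, π/8]` to `[π/8, π]`. -/
noncomputable def renormX (c a : ℝ) : ℝ := -c + 2 * silver * a

/-- The heights along `chain`, normalized to be antisymmetric. -/
noncomputable def chainHeight (c a : ℝ) : ℕ → ℝ
  | 0 => center 0 (renormX c a) a A
  | n + 1 => chainHeight c a n + center 0 c a (chain n) + center 0 c a (chain (n + 1))

/-- Rational relations between the projections `a, b, c, d` of the sides. -/
theorem exists_projections {c a : ℝ} (h : BaseSector c a) :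
    ∃ b d : ℝ, (√2 * a = b - d ∧ √2 * b = a + c ∧ √2 * c = b + d ∧ √2 * d = c - a) ∧
      (0 ≤ a ∧ a ≤ d ∧ 0 < d ∧ b ≤ c ∧ d + 1.4 * a ≤ b ∧ b ≤ d + 1.5 * a ∧ a + 1.4 * d ≤ c ∧
        c ≤ a + 1.5 * d) ∧
      b = √2 / 2 * (c + a) ∧ d = √2 / 2 * (c - a) := by
  have hs := sqrt_two_mul_self
  obtain ⟨h4, h5⟩ := sqrt_two_bounds
  obtain ⟨h1, h2, h3⟩ := h
  unfold silver at h2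
  have e1 : √2 * (√2 * c) = 2 * c := by rw [← mul_assoc, hs]
  have e2 : √2 * (√2 * a) = 2 * a := by rw [← mul_assoc, hs]
  have h6 : a ≤ √2 / 2 * (c - a) := by nlinarith
  have h7 : 0 < √2 / 2 * (c - a) := by
    have : 0 < c - a := by nlinarith
    positivity
  refine ⟨√2 / 2 * (c + a), √2 / 2 * (c - a), ⟨?_, ?_, ?_, ?_⟩, ⟨h1, h6, h7, ?_, ?_, ?_, ?_, ?_⟩,
    rfl, rfl⟩
  all_goals first | linarith | nlinarith

/-- Everything becomes an integral combination of the four projections `a, b, c, d`, so that the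
later case checks are linear and free of `√2`. -/
theorem renorm_table {c a b d : ℝ} (ha : √2 * a = b - d)
    (hc : √2 * c = b + d)
    (hb' : b = √2 / 2 * (c + a)) (hd' : d = √2 / 2 * (c - a)) :
    (radius 0 c a A = a ∧ radius 0 c a B = b ∧ radius 0 c a C = c ∧ radius 0 c a D = d) ∧
    (center 0 c a A = b + c + d ∧ center 0 c a B = c + d - a ∧ center 0 c a C = d - a - b ∧
      center 0 c a D = -a - b - c) ∧
    (∀ k, radius k (renormX c a) a A = a ∧
      radius k (renormX c a) a B = exitSign k B * (2 * a + b - 2 * d) ∧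
      radius k (renormX c a) a C = exitSign k C * (2 * a + 2 * b - 2 * d - c) ∧
      radius k (renormX c a) a D = exitSign k D * (2 * a - d)) ∧
    (chainHeight c a 0 = 6 * a + 3 * b - c - 5 * d ∧ chainHeight c a 1 = 5 * a + 3 * b - c - 4 * d ∧
      chainHeight c a 2 = 3 * a + 2 * b - c - 3 * d ∧ chainHeight c a 3 = a + b - d ∧
      chainHeight c a 4 = d - a - b ∧ chainHeight c a 5 = -3 * a - 2 * b + c + 3 * d ∧
      chainHeight c a 6 = -5 * a - 3 * b + c + 4 * d ∧
      chainHeight c a 7 = -6 * a - 3 * b + c + 5 * d) := by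
  have hs := sqrt_two_mul_self
  have e1 : √2 * (√2 * a) = 2 * a := by rw [← mul_assoc, hs]
  have e2 : √2 * (√2 * c) = 2 * c := by rw [← mul_assoc, hs]
  have hr : (radius 0 c a A = a ∧ radius 0 c a B = b ∧ radius 0 c a C = c ∧ radius 0 c a D = d) := by
    simp [radius, exitSign, normalDot, hb', hd']
  have hc : (center 0 c a A = b + c + d ∧ center 0 c a B = c + d - a ∧ center 0 c a C = d - a - b ∧
      center 0 c a D = -a - b - c) := by
    refine ⟨?_, ?_, ?_, ?_⟩ <;> simp [center, exitSign, normalCross, silver] <;>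
      linarith [e1, e2]
  obtain ⟨cA, cB, cC, cD⟩ := hc
  refine ⟨hr, ⟨cA, cB, cC, cD⟩, fun k => ⟨?_, ?_, ?_, ?_⟩, ?_⟩
  · simp [radius, exitSign, normalDot]
  · simp only [radius, normalDot, renormX, silver]
    congr 1
    linarith
  · simp only [radius, normalDot, renormX, silver]
    congr 1
    linarith
  · simp only [radius, normalDot, renormX, silver]
    congr 1
    linarith
  have h0 : chainHeight c a 0 = 6 * a + 3 * b - c - 5 * d := by
    simp only [chainHeight, center, exitSign, normalCross, renormX, silver]
    linarith
  simp only [chainHeight] at h0 ⊢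
  simp only [h0, chain, cA, cB, cC, cD, true_and]
  refine ⟨?_, ?_, ?_, ?_, ?_, ?_, ?_⟩ <;> ring

/-- The key identity: the centers for the renormalized direction are the heights accumulated along
`chain` up to the point where the piece issuing from `L` starts. -/
theorem center_renorm {c a : ℝ} (h : BaseSector c a) (k : Fin 4) (L : Letter) :
    center k (renormX c a) a L = chainHeight c a (startIndex k L) := by
  obtain ⟨b, d, ⟨ha, -, hc, -⟩, -, hb', hd'⟩ := exists_projections h
  obtain ⟨-, -, -, h0, h1, h2, h3, h4, h5, h6, h7⟩ := renorm_table ha hc hb' hd'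
  have hs := sqrt_two_mul_self
  have e1 : √2 * (√2 * a) = 2 * a := by rw [← mul_assoc, hs]
  have e2 : √2 * (√2 * c) = 2 * c := by rw [← mul_assoc, hs]
  have e3 : √2 * (√2 * (√2 * a)) = 2 * (√2 * a) := by rw [← mul_assoc, hs]
  cases L <;> fin_cases k <;>
    simp [startIndex, h0, h1, h2, h3, h4, h5, h6, center, exitSign, normalCross, renormX, silver] <;>
    linarith

theorem chainHeight_reflect {c a : ℝ} (h : BaseSector c a) {j : ℕ} (hj : j ≤ 7) :
    chainHeight c a (7 - j) = -chainHeight c a j := by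
  obtain ⟨b, d, ⟨ha, -, hc, -⟩, -, hb', hd'⟩ := exists_projections h
  obtain ⟨-, -, -, h0, h1, h2, h3, h4, h5, h6, h7⟩ := renorm_table ha hc hb' hd'
  interval_cases j <;> simp only [Nat.reduceSub, h0, h1, h2, h3, h4, h5, h6, h7] <;> ring

theorem edge0_of_heights {c a t : ℝ} (h : BaseSector c a) {L M : Letter} (hL : |t| < radius 0 c a L)
    (hM : |t - center 0 c a L - center 0 c a M| < radius 0 c a M) : Edge0 L M := by
  obtain ⟨b, d, ⟨ha, -, hc, -⟩, hbd, hb', hd'⟩ := exists_projections h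
  obtain ⟨⟨rA, rB, rC, rD⟩, ⟨cA, cB, cC, cD⟩, -⟩ := renorm_table ha hc hb' hd'
  rw [abs_lt] at hL hM
  obtain ⟨hL1, hL2⟩ := hL
  obtain ⟨hM1, hM2⟩ := hM
  obtain ⟨b1, b2, b3, b4, b5, b6, b7, b8⟩ := hbd
  cases L <;> cases M <;> first
    | constructor
    | (exfalso
       simp only [rA, rB, rC, rD, cA, cB, cC, cD] at hL1 hL2 hM1 hM2
       linarith)

/-- The two bounds confine `t` to the intersection of two opposite translates of one interval, which
is centred at `0`. Nonnegativity of the renormalized radii fixes the quarter `k`. The intersection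
is then empty for neighbours outside the group, and otherwise its half-length is the renormalized
radius. -/
theorem sandwich_heights {c a t : ℝ} (h : BaseSector c a) {k : Fin 4}
    (hk : ∀ L, 0 ≤ radius k (renormX c a) a L) {L P : Letter} (hLP : Edge0 L P)
    (ht1 : |t + center 0 c a L + center 0 c a P| < radius 0 c a P)
    (ht2 : |t - center 0 c a L - center 0 c a P| < radius 0 c a P) :
    P = group k L ∧ |t| < radius k (renormX c a) a L := by
  obtain ⟨b, d, ⟨ha, -, hc, -⟩, hbd, hb', hd'⟩ := exists_projections h
  obtain ⟨⟨rA, rB, rC, rD⟩, ⟨cA, cB, cC, cD⟩, hr, -⟩ := renorm_table ha hc hb' hd'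
  obtain ⟨rA', rB', rC', rD'⟩ := hr k
  have kA := hk A
  have kB := hk B
  have kC := hk C
  have kD := hk D
  obtain ⟨b1, b2, b3, b4, b5, b6, b7, b8⟩ := hbd
  rw [abs_lt] at ht1 ht2 ⊢
  obtain ⟨t1, t2⟩ := ht1
  obtain ⟨t3, t4⟩ := ht2
  simp only [rA', rB', rC', rD'] at kA kB kC kD
  cases hLP <;> simp only [rA, rB, rC, rD, cA, cB, cC, cD] at t1 t2 t3 t4 <;>
    simp only [rA', rB', rC', rD'] <;> fin_cases k <;>
    simp [exitSign, group, table] at kA kB kC kD ⊢ <;> first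
      | (constructor <;> linarith)
      | linarith

set_option maxHeartbeats 4000000 in
-- One step of the renormalized coding unfolds to a straight segment which crosses all the sides of
-- the intermediate piece of `chain`. The first conclusion says that this piece has at least one
-- edge.
theorem run_heights {c a t : ℝ} (h : BaseSector c a) {k : Fin 4}
    (hk : ∀ L, 0 ≤ radius k (renormX c a) a L) {L M : Letter}
    (hL : |t| < radius k (renormX c a) a L)
    (hM : |t - chainHeight c a (startIndex k L) - chainHeight c a (startIndex k M)| <
      radius k (renormX c a) a M) :
    startIndex k L + startIndex k M ≤ 6 ∧ ∀ j, startIndex k L ≤ j → j ≤ 7 - startIndex k M →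
      |-t + chainHeight c a (startIndex k L) - chainHeight c a j| < radius 0 c a (chain j) := by
  obtain ⟨b, d, ⟨ha, -, hc, -⟩, hbd, hb', hd'⟩ := exists_projections h
  obtain ⟨⟨rA, rB, rC, rD⟩, -, hr, h0, h1, h2, h3, h4, h5, h6, h7⟩ :=
    renorm_table ha hc hb' hd'
  obtain ⟨rA', rB', rC', rD'⟩ := hr k
  have kA := hk A
  have kB := hk B
  have kC := hk C
  have kD := hk D
  obtain ⟨b1, b2, b3, b4, b5, b6, b7, b8⟩ := hbd
  rw [abs_lt] at hL hM
  obtain ⟨t1, t2⟩ := hL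
  obtain ⟨t3, t4⟩ := hM
  simp only [rA', rB', rC', rD'] at kA kB kC kD
  cases L <;> cases M <;> simp only [rA', rB', rC', rD'] at t1 t2 t3 t4 <;> clear hk rA' rB' rC' rD' <;>
    fin_cases k <;>
    simp [startIndex, h0, h1, h2, h3, h4, h5, h6, exitSign] at t1 t2 t3 t4 kA kB kC kD ⊢ <;> first
    | linarith only [t1, t2, t3, t4, kA, kB, kC, kD, b2, b4]
    | linarith only [t1, t2, t3, t4, kA, kB, kC, kD, b1, b2, b3, b4, b5, b6, b7, b8]
    | (intro j
       intros
       interval_cases j <;>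
         simp only [chain, rA, rB, rC, rD, h0, h1, h2, h3, h4, h5, h6, h7, abs_lt] <;>
         constructor <;> first
         | linarith only [t1, t2, t3, t4, kA, kB, kC, kD, b2, b4]
         | linarith only [t1, t2, t3, t4, kA, kB, kC, kD, b1, b2, b3, b4, b5, b6, b7, b8])

/-! ### Enumerations of sets of integers -/

theorem exists_enumeration {S : Set ℤ} (h1 : ∀ n, ∃ m ∈ S, n < m) (h2 : ∀ n, ∃ m ∈ S, m < n) :
    ∃ e : ℤ → ℤ, StrictMono e ∧ Set.range e = S := by
  classical
  let _ : LocallyFiniteOrder S := inferInstance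
  let _ : SuccOrder S := LinearLocallyFiniteOrder.succOrder S
  let _ : PredOrder S := LinearLocallyFiniteOrder.predOrder S
  have _ : NoMaxOrder S := ⟨fun a => by
    obtain ⟨m, hm, h⟩ := h1 a
    exact ⟨⟨m, hm⟩, h⟩⟩
  have _ : NoMinOrder S := ⟨fun a => by
    obtain ⟨m, hm, h⟩ := h2 a
    exact ⟨⟨m, hm⟩, h⟩⟩
  have _ : Nonempty S := by
    obtain ⟨m, hm, -⟩ := h1 0
    exact ⟨⟨m, hm⟩⟩
  let φ : S ≃o ℤ := orderIsoIntOfLinearSuccPredArch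
  refine ⟨fun n => (φ.symm n : ℤ), fun a b hab => φ.symm.strictMono hab, ?_⟩
  ext n
  constructor
  · rintro ⟨m, rfl⟩
    exact (φ.symm m).2
  · intro hn
    exact ⟨φ ⟨n, hn⟩, by simp⟩

theorem not_mem_range_of_between {e : ℤ → ℤ} (he : StrictMono e) {m n : ℤ} (h1 : e m < n)
    (h2 : n < e (m + 1)) : n ∉ Set.range e := by
  rintro ⟨l, rfl⟩
  have h3 := he.lt_iff_lt.1 h1
  have h4 := he.lt_iff_lt.1 h2
  omega

theorem exists_partial_sums (g : ℤ → ℕ) : ∃ e : ℤ → ℤ, e 0 = 0 ∧ ∀ m, e (m + 1) = e m + g m := by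
  refine ⟨fun m => ∑ i ∈ Finset.range m.toNat, (g i : ℤ) -
    ∑ i ∈ Finset.range (-m).toNat, (g (-i - 1) : ℤ), by simp, fun m => ?_⟩
  obtain ⟨n, rfl | rfl⟩ := m.eq_nat_or_neg
  · have h1 : (-((n : ℤ) + 1)).toNat = 0 := by omega
    have h2 : (-(n : ℤ)).toNat = 0 := by omega
    have h3 : ((n : ℤ) + 1).toNat = n + 1 := by omega
    simp only [h1, h2, h3, Int.toNat_natCast, Finset.sum_range_succ, Finset.range_zero,
      Finset.sum_empty]
    ring
  · cases n with
    | zero => simp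
    | succ n =>
      have h1 : (-((n + 1 : ℕ) : ℤ) + 1).toNat = 0 := by omega
      have h2 : (-((n + 1 : ℕ) : ℤ)).toNat = 0 := by omega
      have h3 : (-(-((n + 1 : ℕ) : ℤ))).toNat = n + 1 := by omega
      have h4 : (-(-((n + 1 : ℕ) : ℤ) + 1)).toNat = n := by omega
      have h5 : -((n + 1 : ℕ) : ℤ) = -(n : ℤ) - 1 := by push_cast; ring
      simp only [h1, h2, h3, h4, Finset.sum_range_succ, Finset.range_zero, Finset.sum_empty]
      rw [h5]
      ring

theorem strictMono_of_gaps {e : ℤ → ℤ} {g : ℤ → ℕ} (hg : ∀ m, 1 ≤ g m)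
    (he : ∀ m, e (m + 1) = e m + g m) : StrictMono e := by
  refine strictMono_int_of_lt_succ fun m => ?_
  have := hg m
  rw [he]
  omega

theorem exists_block {e : ℤ → ℤ} {g : ℤ → ℕ} (hg : ∀ m, 1 ≤ g m)
    (he : ∀ m, e (m + 1) = e m + g m) (n : ℤ) : ∃ m, ∃ i : ℕ, i < g m ∧ n = e m + i := by
  have hup : ∀ m : ℕ, e 0 + m ≤ e m := by
    intro m
    induction m with
    | zero => simp
    | succ m ih =>
      have := hg m
      have := he m
      push_cast
      omega
  have hdown : ∀ m : ℕ, e (-m) ≤ e 0 - m := by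
    intro m
    induction m with
    | zero => simp
    | succ m ih =>
      have h1 := hg (-((m + 1 : ℕ) : ℤ))
      have h2 := he (-((m + 1 : ℕ) : ℤ))
      have h3 : -((m + 1 : ℕ) : ℤ) + 1 = -(m : ℤ) := by push_cast; ring
      rw [h3] at h2
      push_cast at *
      omega
  have hmono := strictMono_of_gaps hg he
  obtain ⟨m, hm1, hm2⟩ := Int.exists_greatest_of_bdd (P := fun m => e m ≤ n)
    ⟨((n - e 0).toNat + 1 : ℕ), fun z hz => by
      by_contra hlt
      push Not at hlt
      have h1 := hmono hlt
      have h2 := hup ((n - e 0).toNat + 1)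
      push_cast at *
      omega⟩
    ⟨-((e 0 - n).toNat : ℕ), by
      have := hdown (e 0 - n).toNat
      omega⟩
  have h1 : n < e (m + 1) := by
    by_contra hlt
    have := hm2 (m + 1) (by omega)
    omega
  have := he m
  exact ⟨m, (n - e m).toNat, by omega, by omega⟩

/-- Consecutive blocks share an end point, so a relation between neighbouring positions can always
be checked inside a single block. -/
theorem exists_glued {α : Type*} {e : ℤ → ℤ} {g : ℤ → ℕ} (hg : ∀ m, 1 ≤ g m)
    (he : ∀ m, e (m + 1) = e m + g m) (F : ℤ → ℕ → α) (hF : ∀ m, F m (g m) = F (m + 1) 0) :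
    ∃ f : ℤ → α, ∀ m, ∀ i ≤ g m, f (e m + i) = F m i := by
  have hmono := strictMono_of_gaps hg he
  choose M I hI hMI using exists_block hg he
  have key : ∀ m, ∀ i < g m, F (M (e m + i)) (I (e m + i)) = F m i := by
    intro m i hi
    have h1 := hI (e m + i)
    have h2 := hMI (e m + i)
    have h3 := he (M (e m + i))
    have h4 := he m
    have h5 : M (e m + i) = m := by
      have h6 : e (M (e m + i)) < e (m + 1) := by omega
      have h7 : e m < e (M (e m + i) + 1) := by omega
      have := hmono.lt_iff_lt.1 h6
      have := hmono.lt_iff_lt.1 h7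
      omega
    have h6 : I (e m + i) = i := by
      rw [h5] at h2
      omega
    rw [h5, h6]
  refine ⟨fun n => F (M n) (I n), fun m i hi => ?_⟩
  rcases hi.lt_or_eq with hi | rfl
  · exact key m i hi
  · have := key (m + 1) 0 (hg _)
    rw [hF, ← this, he]
    simp

/-! ### Sandwiched letters of paths -/

/-- The word is an infinite path on the transition diagram of the sector `[0, π/8]`. -/
def IsPath (u : Word) : Prop := ∀ n, Edge0 (u n) (u (n + 1))

/-- The index of the edge of the path at time `n`. -/
def edgeAt (u : Word) (n : ℤ) : ℕ := edgeIndex (u n) (u (n + 1))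

theorem IsPath.edgeAt_succ {u : Word} (h : IsPath u) {n : ℤ} (hn : ¬ Sandwiched u (n + 1)) :
    edgeAt u (n + 1) = edgeAt u n + 1 := by
  refine (h n).edgeIndex_succ (h (n + 1)) fun h' => hn ?_
  simpa [Sandwiched] using h'

theorem IsPath.edgeAt_add {u : Word} (h : IsPath u) {n : ℤ} {m : ℕ}
    (hn : ∀ i : ℕ, 1 ≤ i → i ≤ m → ¬ Sandwiched u (n + i)) : edgeAt u (n + m) = edgeAt u n + m := by
  induction m with
  | zero => simp
  | succ m ih =>
    have h1 := ih fun i hi hi' => hn i hi (by omega)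
    have h2 := hn (m + 1) (by omega) le_rfl
    push_cast at h2 ⊢
    rw [← add_assoc] at h2 ⊢
    rw [h.edgeAt_succ h2, h1]
    ring

/-- Seven steps without backtracking would push the edge index above `6`. The bounded gap makes
derived words exist and makes derivation compatible with limits. -/
theorem IsPath.exists_sandwiched {u : Word} (h : IsPath u) (n : ℤ) :
    ∃ m, Sandwiched u m ∧ n < m ∧ m < n + 8 := by
  by_contra! hcon
  have := h.edgeAt_add (n := n) (m := 7) fun i hi hi' hs => by
    have := hcon _ hs (by omega)
    omega
  have h2 : edgeAt u (n + (7 : ℕ)) ≤ 6 := (h _).edgeIndex_le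
  omega

theorem IsPath.exists_isDerived {u : Word} (h : IsPath u) : ∃ v, IsDerived u v := by
  obtain ⟨e, he, hr⟩ := exists_enumeration (S := {n | Sandwiched u n})
    (fun n => by
      obtain ⟨m, hm, h1, h2⟩ := h.exists_sandwiched n
      exact ⟨m, hm, h1⟩)
    (fun n => by
      obtain ⟨m, hm, h1, h2⟩ := h.exists_sandwiched (n - 8)
      exact ⟨m, hm, by omega⟩)
  exact ⟨fun n => u (e n), e, he, hr, fun _ => rfl⟩

/-- The word between two consecutive sandwiched letters. -/
theorem IsPath.block {u : Word} (h : IsPath u) {k : Fin 4} (hk : SandwichedInGroup k u) {e : ℤ → ℤ}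
    (he : StrictMono e) (hr : Set.range e = {n | Sandwiched u n}) (m : ℤ) :
    ∃ g : ℕ, g + startIndex k (u (e m)) + startIndex k (u (e (m + 1))) = 7 ∧ 1 ≤ g ∧
      e (m + 1) = e m + g ∧ ∀ i ≤ g, u (e m + i) = chain (startIndex k (u (e m)) + i) := by
  have hS : ∀ l, Sandwiched u (e l) := fun l => by
    have : e l ∈ {n | Sandwiched u n} := hr ▸ Set.mem_range_self l
    exact this
  have hlt : e m < e (m + 1) := he (by omega)
  obtain ⟨g, hg⟩ : ∃ g : ℕ, e (m + 1) = e m + (g + 1 : ℕ) :=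
    ⟨(e (m + 1) - e m - 1).toNat, by omega⟩
  have hrun : ∀ i ≤ g, edgeAt u (e m + i) = edgeAt u (e m) + i := by
    intro i hi
    refine h.edgeAt_add fun j hj hj' hs => ?_
    refine not_mem_range_of_between he (m := m) (n := e m + j) (by omega) (by omega) ?_
    rw [hr]
    exact hs
  have hL : edgeAt u (e m) = startIndex k (u (e m)) := by
    have h1 := hk _ (hS m)
    have h2 := hS m
    rw [Sandwiched, h1] at h2
    have h3 := h (e m)
    rw [← h2] at h3
    rw [edgeAt, ← h2, edgeIndex_group h3]
  -- The arriving edge is the reverse of the edge from the sandwiched letter to its group neighbour,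
  -- and reversal reflects `chain`.
  have hM : edgeAt u (e (m + 1) - 1) = 6 - startIndex k (u (e (m + 1))) := by
    have h1 := hk _ (hS (m + 1))
    have h3 := h (e (m + 1) - 1)
    rw [edgeAt, sub_add_cancel, h1] at *
    rw [h3.symm.edgeIndex_swap, edgeIndex_group h3.symm]
  have h4 : e (m + 1) - 1 = e m + g := by omega
  have h5 := startIndex_le k (u (e (m + 1)))
  rw [h4, hrun g le_rfl, hL] at hM
  refine ⟨g + 1, by omega, by omega, hg, fun i hi => ?_⟩
  rcases Nat.lt_or_ge g i with h6 | h6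
  · obtain rfl : i = g + 1 := by omega
    have h7 := (h (e m + g)).chain_edgeIndex.2
    have h8 := hrun g le_rfl
    rw [edgeAt] at h8
    rw [h8, hL] at h7
    rw [← add_assoc, h7]
    push_cast
    rw [add_assoc]
  · have h7 := (h (e m + i)).chain_edgeIndex.1
    have h8 := hrun i h6
    rw [edgeAt] at h8
    rw [h8, hL] at h7
    exact h7.symm

/-! ### Derivation and generation of codings -/

theorem IsCoding.isPath {c a : ℝ} (h : BaseSector c a) {u : Word}
    (hu : IsCoding (radius 0 c a) (center 0 c a) u) : IsPath u := by
  obtain ⟨t, ht⟩ := hu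
  intro n
  have h1 := (ht (n + 1)).1
  rw [(ht n).2] at h1
  exact edge0_of_heights h (ht n).1 h1

theorem IsCoding.derive {c a : ℝ} (h : BaseSector c a) {k : Fin 4}
    (hk : ∀ L, 0 ≤ radius k (renormX c a) a L) {u : Word}
    (hu : IsCoding (radius 0 c a) (center 0 c a) u) :
    SandwichedInGroup k u ∧ ∀ v, IsDerived u v →
      IsCoding (radius k (renormX c a) a) (center k (renormX c a) a) v := by
  have hpath := hu.isPath h
  obtain ⟨t, ht⟩ := hu
  have key : ∀ n, Sandwiched u n → u (n + 1) = group k (u n) ∧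
      |t n| < radius k (renormX c a) a (u n) := by
    intro n hn
    have h1 := (ht (n - 1)).1
    have h2 := (ht (n - 1)).2
    have h3 := (ht (n + 1)).1
    rw [(ht n).2] at h3
    rw [sub_add_cancel] at h2
    rw [Sandwiched] at hn
    rw [hn] at h1 h2
    have h4 : t (n - 1) = t n + center 0 c a (u n) + center 0 c a (u (n + 1)) := by linarith
    rw [h4] at h1
    exact sandwich_heights h hk (hpath n) h1 h3
  have hgroup : SandwichedInGroup k u := fun n hn => by
    have h1 := (key n hn).1
    rw [Sandwiched] at hn
    rw [hn, h1]
  refine ⟨hgroup, ?_⟩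
  rintro v ⟨e, he, hr, hv⟩
  obtain rfl : v = fun n => u (e n) := funext hv
  -- The sign reflects that the renormalization reverses orientation.
  refine ⟨fun m => -t (e m), fun m => ⟨?_, ?_⟩⟩
  · rw [abs_neg]
    refine (key _ ?_).2
    have : e m ∈ {n | Sandwiched u n} := hr ▸ Set.mem_range_self m
    exact this
  obtain ⟨g, hg1, hg2, hg3, hg4⟩ := hpath.block hgroup he hr m
  -- A conserved quantity: the increments of `chainHeight` compensate those of `t`. At the end of
  -- the block, the antisymmetry of `chainHeight` produces the center of the next letter.
  have hcons : ∀ i ≤ g, t (e m + i) + chainHeight c a (startIndex k (u (e m)) + i) =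
      t (e m) + chainHeight c a (startIndex k (u (e m))) := by
    intro i
    induction i with
    | zero => simp
    | succ i ih =>
      intro hi
      have h1 := ih (by omega)
      have h2 := (ht (e m + i)).2
      have h3 := hg4 i (by omega)
      have h4 := hg4 (i + 1) hi
      push_cast at h4 ⊢
      rw [← add_assoc] at h4 ⊢
      rw [h3, h4, ← add_assoc] at h2
      rw [← add_assoc, chainHeight, h2]
      linarith
  have h1 := hcons g le_rfl
  rw [← hg3, show startIndex k (u (e m)) + g = 7 - startIndex k (u (e (m + 1))) by omega,
    chainHeight_reflect h (by omega)] at h1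
  simp only [center_renorm h]
  linarith

theorem IsCoding.generate {c a : ℝ} (h : BaseSector c a) {k : Fin 4}
    (hk : ∀ L, 0 ≤ radius k (renormX c a) a L) {v : Word}
    (hv : IsCoding (radius k (renormX c a) a) (center k (renormX c a) a) v) :
    ∃ u, IsCoding (radius 0 c a) (center 0 c a) u ∧ IsDerived u v ∧ SandwichedInGroup k u := by
  obtain ⟨t, ht⟩ := hv
  have hrun : ∀ m, startIndex k (v m) + startIndex k (v (m + 1)) ≤ 6 ∧
      ∀ j, startIndex k (v m) ≤ j → j ≤ 7 - startIndex k (v (m + 1)) →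
      |-t m + chainHeight c a (startIndex k (v m)) - chainHeight c a j| <
        radius 0 c a (chain j) := by
    intro m
    have h1 := (ht (m + 1)).1
    rw [(ht m).2] at h1
    simp only [center_renorm h] at h1
    exact run_heights h hk (ht m).1 h1
  -- This is the block length forced by `IsPath.block`; `run_heights` guarantees that the truncated
  -- subtractions are genuine.
  let g : ℤ → ℕ := fun m => 7 - startIndex k (v m) - startIndex k (v (m + 1))
  have hg : ∀ m, 1 ≤ g m := fun m => by
    have := (hrun m).1
    simp only [g]
    omega
  have hgE : ∀ m, startIndex k (v m) + g m = 7 - startIndex k (v (m + 1)) := fun m => by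
    have := (hrun m).1
    simp only [g]
    omega
  obtain ⟨e, -, he⟩ := exists_partial_sums g
  have hmono := strictMono_of_gaps hg he
  have hle := fun m => startIndex_le k (v m)
  obtain ⟨u, hu⟩ := exists_glued hg he (fun m i => chain (startIndex k (v m) + i)) fun m => by
    rw [hgE, chain_reflect (by have := hle (m + 1); omega), add_zero]
  obtain ⟨s, hs⟩ := exists_glued hg he
    (fun m i => -t m + chainHeight c a (startIndex k (v m)) -
      chainHeight c a (startIndex k (v m) + i)) fun m => by
    rw [hgE, chainHeight_reflect h (by have := hle (m + 1); omega), add_zero, (ht m).2,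
      center_renorm h, center_renorm h]
    ring
  have hue : ∀ m, u (e m) = v m := fun m => by
    have := hu m 0 (Nat.zero_le _)
    simpa [chain_startIndex] using this
  have hsucc : ∀ m, u (e m + 1) = group k (v m) := fun m => by
    have := hu m 1 (hg m)
    simpa [chain_startIndex_succ] using this
  -- The preceding block, read backwards through the reflection of `chain`, also starts with the
  -- edge from `v m` to its group neighbour.
  have hpred : ∀ m, u (e m - 1) = group k (v m) := fun m => by
    have h1 := he (m - 1)
    have h2 := hgE (m - 1)
    have h3 := hg (m - 1)
    have h4 := hle m
    rw [sub_add_cancel] at h1 h2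
    have := hu (m - 1) (g (m - 1) - 1) (by omega)
    rw [show e (m - 1) + ((g (m - 1) - 1 : ℕ) : ℤ) = e m - 1 by omega,
      show startIndex k (v (m - 1)) + (g (m - 1) - 1) = 7 - (startIndex k (v m) + 1) by omega,
      chain_reflect (by omega), chain_startIndex_succ] at this
    exact this
  have hsand : ∀ n, Sandwiched u n ↔ n ∈ Set.range e := by
    intro n
    constructor
    · intro hn
      obtain ⟨m, i, hi, rfl⟩ := exists_block hg he n
      rcases Nat.eq_zero_or_pos i with rfl | hi0
      · exact ⟨m, by simp⟩
      · exfalso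
        have h1 := hu m (i - 1) (by omega)
        have h2 := hu m (i + 1) (by omega)
        have h3 := hgE m
        rw [show e m + ((i - 1 : ℕ) : ℤ) = e m + i - 1 by omega] at h1
        rw [show e m + ((i + 1 : ℕ) : ℤ) = e m + i + 1 by omega] at h2
        rw [Sandwiched, h1, h2] at hn
        refine chain_ne (j := startIndex k (v m) + i) (by omega) (by omega) ?_
        rw [Nat.add_sub_assoc (by omega), hn, add_assoc]
    · rintro ⟨m, rfl⟩
      rw [Sandwiched, hpred, hsucc]
  refine ⟨u, ⟨s, fun n => ?_⟩, ⟨e, hmono, ?_, fun m => (hue m).symm⟩, ?_⟩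
  · obtain ⟨m, i, hi, rfl⟩ := exists_block hg he n
    have h1 := hu m i hi.le
    have h2 := hu m (i + 1) hi
    have h3 := hs m i hi.le
    have h4 := hs m (i + 1) hi
    have h5 := hgE m
    rw [show e m + ((i + 1 : ℕ) : ℤ) = e m + i + 1 by omega] at h2 h4
    rw [h1, h2, h3, h4, ← add_assoc, chainHeight]
    exact ⟨(hrun m).2 _ (by omega) (by omega), by ring⟩
  · ext n
    exact (hsand n).symm
  · intro n hn
    obtain ⟨m, rfl⟩ := (hsand n).1 hn
    rw [hpred, hue]

/-! ### Derivation and generation in the sectors -/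

theorem perm_zero (L : Letter) : perm 0 L = L := by
  cases L <;> rfl

theorem relabel_zero (w : Word) : relabel 0 w = w := funext fun n => perm_zero (w n)

theorem exists_perm_inverse (j : Fin 8) :
    ∃ i : Fin 8, (∀ L, perm i (perm j L) = L) ∧ ∀ L, perm j (perm i L) = L := by
  have hinv : ∀ i : Fin 8, (perm i (perm j A) = A ∧ perm i (perm j B) = B ∧ perm i (perm j C) = C ∧
      perm i (perm j D) = D) → (∀ L, perm i (perm j L) = L) := by
    rintro i ⟨h1, h2, h3, h4⟩ L
    cases L <;> assumption
  -- Only the two 4-cycles, at indices `2` and `6`, are not involutions.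
  refine ⟨(![0, 1, 6, 3, 4, 5, 2, 7] : Fin 8 → Fin 8) j, ?_, ?_⟩ <;> intro L <;> fin_cases j <;>
    cases L <;> rfl

theorem exists_perm_mul (i j : Fin 8) : ∃ l : Fin 8, ∀ L, perm l L = perm i (perm j L) := by
  have hl : ∀ l, (perm l A = perm i (perm j A) ∧ perm l B = perm i (perm j B) ∧
      perm l C = perm i (perm j C) ∧ perm l D = perm i (perm j D)) →
      ∃ l : Fin 8, ∀ L, perm l L = perm i (perm j L) := by
    rintro l ⟨h1, h2, h3, h4⟩
    exact ⟨l, fun L => by cases L <;> assumption⟩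
  fin_cases i <;> fin_cases j <;> first
    | exact hl 0 ⟨rfl, rfl, rfl, rfl⟩
    | exact hl 1 ⟨rfl, rfl, rfl, rfl⟩
    | exact hl 2 ⟨rfl, rfl, rfl, rfl⟩
    | exact hl 3 ⟨rfl, rfl, rfl, rfl⟩
    | exact hl 4 ⟨rfl, rfl, rfl, rfl⟩
    | exact hl 5 ⟨rfl, rfl, rfl, rfl⟩
    | exact hl 6 ⟨rfl, rfl, rfl, rfl⟩
    | exact hl 7 ⟨rfl, rfl, rfl, rfl⟩

theorem perm_injective (j : Fin 8) : Function.Injective (perm j) := by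
  obtain ⟨i, hi, -⟩ := exists_perm_inverse j
  exact Function.LeftInverse.injective hi

theorem exists_relabel_eq (j : Fin 8) (u : Word) : ∃ w, relabel j w = u := by
  obtain ⟨i, -, hi⟩ := exists_perm_inverse j
  exact ⟨relabel i u, funext fun n => hi (u n)⟩

theorem inSector_iff {j : Fin 8} {w : Word} : w ∈ InSector j ↔ relabel j w ∈ InSector 0 := by
  simp only [InSector, Set.mem_ofPred_eq, relabel_zero]

theorem generate_mem_inSector {j : Fin 8} (hj : j ≠ 0) {v : Word} (hv : v ∈ InSector j) :
    ∃ u ∈ InSector 0, IsPath u ∧ IsDerived u v ∧ SandwichedInGroup (quarter j) u := by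
  obtain ⟨c, a, h, hc⟩ := hv
  rw [← isCoding_sector_iff] at hc
  obtain ⟨h1, h2⟩ := h.sector_bounds j
  obtain ⟨h2, h3⟩ := h2 hj
  have hk := radius_sector_nonneg h j
  set x := sectorX j c a
  set y := sectorY j c a
  -- For a fixed second coordinate the renormalization is an involution, so its inverse is given by
  -- the same formula.
  have hb : BaseSector (-x + 2 * silver * y) y := ⟨h1, by linarith, h3⟩
  have hx : renormX (-x + 2 * silver * y) y = x := by
    unfold renormX
    ring
  rw [← hx] at hc hk
  obtain ⟨u, hu1, hu2, hu3⟩ := hc.generate hb hk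
  exact ⟨u, ⟨_, _, hb, by rwa [relabel_zero]⟩, hu1.isPath hb, hu2, hu3⟩

theorem derive_mem_inSector {u : Word} (hu : u ∈ InSector 0) :
    ∃ j : Fin 8, j ≠ 0 ∧ IsPath u ∧ SandwichedInGroup (quarter j) u ∧
      ∀ v, IsDerived u v → v ∈ InSector j := by
  obtain ⟨c, a, h, hc⟩ := hu
  rw [relabel_zero] at hc
  obtain ⟨h1, h2, h3⟩ := id h
  have h4 : renormX c a ≠ 0 ∨ a ≠ 0 := by
    by_cases h0 : a = 0
    · left
      subst h0
      simpa [renormX] using h3.ne'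
    · exact Or.inr h0
  obtain ⟨j, hj, c', a', h', hx, hy⟩ := exists_sector h1 h4 (by unfold renormX; linarith)
  have hk := radius_sector_nonneg h' j
  rw [← hx, ← hy] at hk
  obtain ⟨h5, h6⟩ := hc.derive h hk
  refine ⟨j, hj, hc.isPath h, h5, fun v hv => ⟨c', a', h', ?_⟩⟩
  rw [← isCoding_sector_iff, ← hx, ← hy]
  exact h6 v hv

/-! ### Windows of coherent words -/

/-- Each block is determined by the group and its two end letters, so equal windows of derived words
lift to equal windows. -/
theorem IsPath.eq_of_derived_eq {u u' : Word} (hu : IsPath u) (hu' : IsPath u') {k : Fin 4}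
    (hk : SandwichedInGroup k u) (hk' : SandwichedInGroup k u') {e e' : ℤ → ℤ}
    (he : StrictMono e) (hr : Set.range e = {n | Sandwiched u n})
    (he' : StrictMono e') (hr' : Set.range e' = {n | Sandwiched u' n}) (p : ℤ) (N : ℕ)
    (h : ∀ i ≤ N, u (e (p + i)) = u' (e' (p + i))) :
    e (p + N) - e p = e' (p + N) - e' p ∧
      ∀ i : ℕ, (i : ℤ) ≤ e (p + N) - e p → u (e p + i) = u' (e' p + i) := by
  induction N with
  | zero =>
    refine ⟨by simp, fun i hi => ?_⟩
    obtain rfl : i = 0 := by simpa using hi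
    simpa using h 0 le_rfl
  | succ N ih =>
    obtain ⟨h1, h2⟩ := ih fun i hi => h i (by omega)
    obtain ⟨g, hg1, hg2, hg3, hg4⟩ := hu.block hk he hr (p + N)
    obtain ⟨g', hg1', hg2', hg3', hg4'⟩ := hu'.block hk' he' hr' (p + N)
    have h3 := h N (by omega)
    have h4 := h (N + 1) le_rfl
    push_cast at h4 ⊢
    rw [← add_assoc] at h4 ⊢
    rw [h3, h4] at hg1
    obtain rfl : g = g' := by omega
    refine ⟨by omega, fun i hi => ?_⟩
    by_cases hi' : (i : ℤ) ≤ e (p + N) - e p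
    · exact h2 i hi'
    · have h5 := hg4 (i - (e (p + N) - e p)).toNat (by omega)
      have h6 := hg4' (i - (e (p + N) - e p)).toNat (by omega)
      rw [show e (p + N) + (((i : ℤ) - (e (p + N) - e p)).toNat : ℤ) = e p + i by omega] at h5
      rw [show e' (p + N) + (((i : ℤ) - (e (p + N) - e p)).toNat : ℤ) = e' p + i by omega] at h6
      rw [h5, h6, h3]

/-- The alternating word. -/
noncomputable def alternating (P Q : Letter) : Word := fun n => if Even n then P else Q

theorem isCoding_alternating {r q : Letter → ℝ} {P Q : Letter} (hP : 0 < r P) (hQ : 0 < r Q)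
    (hPQ : q P + q Q = 0) : IsCoding r q (alternating P Q) := by
  refine ⟨fun _ => 0, fun n => ⟨?_, ?_⟩⟩
  · unfold alternating
    split_ifs <;> simpa
  · unfold alternating
    by_cases h : Even n
    · simp only [h, Int.even_add_one, if_true, not_true_eq_false, if_false]
      linarith
    · simp only [h, Int.even_add_one, if_true, not_false_eq_true, if_false]
      linarith

/-- A periodic trajectory joins the midpoints of the two sides, with all heights zero. Its direction
is one of the two boundary rays of the sector: `base1` is the angle `π/8` and `base2` the angle `0`.
-/
theorem alternating_mem_inSector {P Q : Letter} (h : Edge0 P Q) : alternating P Q ∈ InSector 0 := by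
  have hs := silver_bounds
  have h2 := sqrt_two_mul_self
  have base1 : BaseSector silver 1 := ⟨by norm_num, by simp, by linarith⟩
  have base2 : BaseSector 1 0 := ⟨le_rfl, by simp, by norm_num⟩
  have hh : √2 / 2 * (silver - 1) = 1 ∧ √2 / 2 * (silver + 1) = silver := by
    unfold silver
    constructor <;> linarith
  have main : ∀ c a, BaseSector c a → 0 < radius 0 c a P → 0 < radius 0 c a Q →
      center 0 c a P + center 0 c a Q = 0 → alternating P Q ∈ InSector 0 := by
    intro c a h hP hQ hPQ
    refine ⟨c, a, h, ?_⟩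
    rw [relabel_zero]
    exact isCoding_alternating hP hQ hPQ
  cases h
  · refine main _ _ base1 ?_ ?_ ?_ <;> simp [radius, center, exitSign, normalDot, normalCross, hh]
  · refine main _ _ base1 ?_ ?_ ?_ <;> simp [radius, center, exitSign, normalDot, normalCross, hh]
  · refine main _ _ base2 ?_ ?_ ?_ <;> simp [radius, center, exitSign, normalDot, normalCross]
  · refine main _ _ base2 ?_ ?_ ?_ <;> simp [radius, center, exitSign, normalDot, normalCross]
  · refine main _ _ base1 ?_ ?_ ?_ <;>
      simp [radius, center, exitSign, normalDot, normalCross, hh]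
    all_goals linarith
  · refine main _ _ base1 ?_ ?_ ?_ <;>
      simp [radius, center, exitSign, normalDot, normalCross, hh]
    all_goals linarith
  · refine main _ _ base2 ?_ ?_ ?_ <;> simp [radius, center, exitSign, normalDot, normalCross]

/-- A sequence of coherent words, each of which is derived from a relabelling of the preceding. -/
def IsCoherentTower (s : ℕ → Fin 8) (W : ℕ → Word) : Prop :=
  ∀ k, s (k + 1) ≠ 0 ∧ IsPath (relabel (s k) (W k)) ∧
    SandwichedInGroup (quarter (s (k + 1))) (relabel (s k) (W k)) ∧
    IsDerived (relabel (s k) (W k)) (W (k + 1))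

theorem eq_alternating_of_sandwiched {u : Word} {p : ℤ} {N : ℕ}
    (h : ∀ i : ℕ, 1 ≤ i → i + 1 ≤ N → Sandwiched u (p + i)) (i : ℕ) (hi : i ≤ N) :
    u (p + i) = alternating (u p) (u (p + 1)) i := by
  induction i using Nat.twoStepInduction with
  | zero => simp [alternating]
  | one => simp [alternating]
  | more i ih _ =>
    have h1 := h (i + 1) (by omega) (by omega)
    rw [Sandwiched] at h1
    push_cast at h1 ⊢
    rw [show p + ((i : ℤ) + 1) - 1 = p + i by ring, ih (by omega),
      show p + ((i : ℤ) + 1) + 1 = p + (i + 2) by ring] at h1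
    rw [← h1]
    simp [alternating]

/-- The indices strictly between `p` and `q` inject into the interior of the window, and miss at
least the position `a + i`. -/
theorem window_shrinks {e : ℤ → ℤ} (he : StrictMono e) {p q a : ℤ} {N i : ℕ}
    (hp : ∀ m, e m ≤ a → m ≤ p) (hq : ∀ m, a + N ≤ e m → q ≤ m) (hi : 1 ≤ i) (hi' : i + 1 ≤ N)
    (hne : a + i ∉ Set.range e) : q - p < N := by
  have hsub : (Finset.Ioo p q).image e ⊆ (Finset.Ioo a (a + N)).erase (a + i) := by
    intro n hn
    obtain ⟨m, hm, rfl⟩ := Finset.mem_image.1 hn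
    rw [Finset.mem_Ioo] at hm
    rw [Finset.mem_erase, Finset.mem_Ioo]
    refine ⟨fun h => hne ⟨m, h⟩, ?_, ?_⟩
    · by_contra hcon
      have := hp m (by omega)
      omega
    · by_contra hcon
      have := hq m (by omega)
      omega
  have hcard := Finset.card_le_card hsub
  rw [Finset.card_image_of_injective _ he.injective, Finset.card_erase_of_mem
    (by rw [Finset.mem_Ioo]; omega), Int.card_Ioo, Int.card_Ioo] at hcard
  omega

theorem IsCoherentTower.exists_window (N : ℕ) : ∀ {s : ℕ → Fin 8} {W : ℕ → Word},
    IsCoherentTower s W → ∀ a : ℤ, ∃ w ∈ InSector (s 0), ∀ i ≤ N, w (a + i) = W 0 (a + i) := by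
  induction N using Nat.strong_induction_on with
  | _ N ih =>
  intro s W hW a
  obtain ⟨hs, hpath, hgroup, e, he, hr, hv⟩ := hW 0
  suffices h : ∃ u ∈ InSector 0, ∀ i ≤ N, u (a + i) = relabel (s 0) (W 0) (a + i) by
    obtain ⟨u, hu, hu'⟩ := h
    obtain ⟨w, rfl⟩ := exists_relabel_eq (s 0) u
    exact ⟨w, inSector_iff.2 hu, fun i hi => perm_injective _ (hu' i hi)⟩
  set U := relabel (s 0) (W 0) with hU
  -- Passing to the derived word does not shorten a window whose interior letters are all
  -- sandwiched; this case is the base of the induction.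
  by_cases hall : ∀ i : ℕ, 1 ≤ i → i + 1 ≤ N → Sandwiched U (a + i)
  · refine ⟨_, InSector.shift (alternating_mem_inSector (hpath a)) (-a), fun i hi => ?_⟩
    rw [eq_alternating_of_sandwiched hall i hi]
    simp
  push Not at hall
  obtain ⟨i, hi, hi', hne⟩ := hall
  have hrange : ∀ n, n ∈ Set.range e ↔ Sandwiched U n := fun n => by rw [hr]; rfl
  obtain ⟨p, hp, hp'⟩ : ∃ p, e p ≤ a ∧ ∀ m, e m ≤ a → m ≤ p := by
    obtain ⟨m1, h1, h2, h3⟩ := hpath.exists_sandwiched a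
    obtain ⟨m2, h4, h5, h6⟩ := hpath.exists_sandwiched (a - 8)
    obtain ⟨l1, rfl⟩ := (hrange _).2 h1
    obtain ⟨l2, rfl⟩ := (hrange _).2 h4
    refine Int.exists_greatest_of_bdd (P := fun m => e m ≤ a) ⟨l1, fun z hz => ?_⟩
      ⟨l2, by omega⟩
    exact (he.lt_iff_lt.1 (lt_of_le_of_lt hz h2)).le
  obtain ⟨q, hq, hq'⟩ : ∃ q, a + N ≤ e q ∧ ∀ m, a + N ≤ e m → q ≤ m := by
    obtain ⟨m1, h1, h2, h3⟩ := hpath.exists_sandwiched (a + N)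
    obtain ⟨m2, h4, h5, h6⟩ := hpath.exists_sandwiched (a + N - 8)
    obtain ⟨l1, rfl⟩ := (hrange _).2 h1
    obtain ⟨l2, rfl⟩ := (hrange _).2 h4
    refine Int.exists_least_of_bdd (P := fun m => a + N ≤ e m) ⟨l2, fun z hz => ?_⟩
      ⟨l1, by omega⟩
    exact (he.lt_iff_lt.1 (lt_of_lt_of_le (by omega) hz)).le
  have hlt := window_shrinks he hp' hq' hi hi' (by rw [hrange]; exact hne)
  have hpq : p < q := he.lt_iff_lt.1 (by omega)
  obtain ⟨v, hv1, hv2⟩ := ih (q - p).toNat (by omega) (s := fun k => s (k + 1))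
    (W := fun k => W (k + 1)) (fun k => hW (k + 1)) p
  obtain ⟨u, hu1, hu2, ⟨e', he', hr', hv'⟩, hu4⟩ := generate_mem_inSector hs hv1
  obtain ⟨h1, h2⟩ := hpath.eq_of_derived_eq hu2 hgroup hu4 he hr he' hr' p (q - p).toNat
    fun i hi => by rw [← hv', hv2 i hi, ← hv]
  rw [show p + ((q - p).toNat : ℤ) = q by omega] at h1 h2
  refine ⟨_, InSector.shift hu1 (e' p - e p), fun i hi => ?_⟩
  have h3 := h2 (a + i - e p).toNat (by omega)
  rw [show e p + ((a + i - e p).toNat : ℤ) = a + i by omega] at h3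
  rw [h3]
  congr 1
  omega

/-! ### Closures -/

theorem mem_closure_iff_windows {S : Set Word} {w : Word} :
    w ∈ closure S ↔ ∀ N : ℕ, ∃ v ∈ S, ∀ n : ℤ, n.natAbs ≤ N → v n = w n := by
  constructor
  · intro h N
    have hopen : IsOpen ((Finset.Icc (-(N : ℤ)) N : Set ℤ).pi fun n => ({w n} : Set Letter)) :=
      isOpen_set_pi (Finset.finite_toSet _) fun _ _ => isOpen_discrete _
    obtain ⟨v, hv1, hv2⟩ := mem_closure_iff.1 h _ hopen fun n _ => rfl
    refine ⟨v, hv2, fun n hn => hv1 n ?_⟩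
    rw [Finset.mem_coe, Finset.mem_Icc]
    omega
  · intro h
    rw [mem_closure_iff]
    intro o ho hw
    obtain ⟨I, U, hU, hIU⟩ := isOpen_pi_iff.1 ho w hw
    obtain ⟨v, hv1, hv2⟩ := h (∑ n ∈ I, n.natAbs)
    refine ⟨v, hIU fun n hn => ?_, hv1⟩
    rw [hv2 n ?_]
    · exact (hU n hn).2
    · exact Finset.single_le_sum (f := fun n : ℤ => n.natAbs) (fun _ _ => Nat.zero_le _) hn

theorem enumeration_eq {S S' : Set ℤ} {e e' : ℤ → ℤ} (he : StrictMono e) (hr : Set.range e = S)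
    (he' : StrictMono e') (hr' : Set.range e' = S') {p l : ℤ} (h0 : e p = e' l) (N : ℕ)
    (h : ∀ n, e p ≤ n → n ≤ e (p + N) → (n ∈ S ↔ n ∈ S')) (i : ℕ) (hi : i ≤ N) :
    e (p + i) = e' (l + i) := by
  induction i with
  | zero => simpa using h0
  | succ i ih =>
    have h1 := ih (by omega)
    have h2 : e p ≤ e (p + i) := he.monotone (by omega)
    have h3 : e (p + i) < e (p + i + 1) := he (by omega)
    have h4 : e (p + i + 1) ≤ e (p + N) := he.monotone (by omega)
    have h5 : e' (l + i) < e' (l + i + 1) := he' (by omega)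
    push_cast
    rw [← add_assoc, ← add_assoc]
    have h6 : e (p + i + 1) ∈ S' := (h _ (by omega) h4).1 (hr ▸ Set.mem_range_self _)
    have h7 : e' (l + i + 1) ≤ e (p + i + 1) := by
      by_contra hcon
      push Not at hcon
      rw [← hr'] at h6
      exact not_mem_range_of_between he' (by omega) hcon h6
    have h8 : e' (l + i + 1) ∈ S := (h _ (by omega) (by omega)).2 (hr' ▸ Set.mem_range_self _)
    by_contra hne
    rw [← hr] at h8
    exact not_mem_range_of_between he (m := p + i) (by omega) (by omega) h8

/-- All the conditions are local. A window of the derived word depends on a finite window of `u`, so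
approximations of `u` derive to approximations of `v`, up to a shift of the enumeration. -/
theorem derive_mem_closure {j : Fin 8} {u : Word}
    (hu : u ∈ closure {u : Word | IsPath u ∧ SandwichedInGroup (quarter j) u ∧
      ∀ v, IsDerived u v → v ∈ InSector j}) :
    IsPath u ∧ SandwichedInGroup (quarter j) u ∧
      ∃ v, IsDerived u v ∧ v ∈ closure (InSector j) := by
  rw [mem_closure_iff_windows] at hu
  have hpath : IsPath u := by
    intro n
    obtain ⟨u', ⟨h1, -, -⟩, h2⟩ := hu (n.natAbs + 1)
    have h3 := h1 n
    rwa [h2 n (by omega), h2 (n + 1) (by omega)] at h3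
  refine ⟨hpath, ?_, ?_⟩
  · intro n hn
    obtain ⟨u', ⟨-, h1, -⟩, h2⟩ := hu (n.natAbs + 1)
    have h3 := h1 n
    rw [Sandwiched] at *
    rw [h2 n (by omega), h2 (n + 1) (by omega),
      h2 (n - 1) (by omega)] at h3
    exact h3 hn
  obtain ⟨v, e, he, hr, hv⟩ := hpath.exists_isDerived
  refine ⟨v, ⟨e, he, hr, hv⟩, mem_closure_iff_windows.2 fun N => ?_⟩
  obtain ⟨u', ⟨h1, -, h2⟩, h3⟩ := hu ((e (-N)).natAbs + (e N).natAbs + 1)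
  -- Being sandwiched involves both neighbours, hence the margin of one in the window.
  have h4 : ∀ n, e (-N) ≤ n → n ≤ e N → (n ∈ {n | Sandwiched u n} ↔ n ∈ {n | Sandwiched u' n}) := by
    intro n hn hn'
    change u (n - 1) = u (n + 1) ↔ u' (n - 1) = u' (n + 1)
    rw [h3 (n - 1) (by omega), h3 (n + 1) (by omega)]
  obtain ⟨v', e', he', hr', hv'⟩ := h1.exists_isDerived
  have h5 : e (-N) ≤ e N := he.monotone (by omega)
  obtain ⟨l, hl⟩ : e (-N) ∈ Set.range e' := by
    rw [hr', ← h4 _ le_rfl h5, ← hr]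
    exact Set.mem_range_self _
  have h6 := enumeration_eq he hr he' hr' hl.symm (2 * N) (by
    intro n hn hn'
    refine h4 n hn ?_
    rwa [show -(N : ℤ) + (2 * N : ℕ) = N by push_cast; ring] at hn')
  refine ⟨_, InSector.shift (h2 _ ⟨e', he', hr', hv'⟩) (l + N), fun n hn => ?_⟩
  have h7 := h6 (n + N).toNat (by omega)
  rw [show -(N : ℤ) + ((n + N).toNat : ℤ) = n by omega,
    show l + ((n + N).toNat : ℤ) = n + (l + N) by omega] at h7
  have h8 : e (-N) ≤ e n := he.monotone (by omega)
  have h9 : e n ≤ e N := he.monotone (by omega)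
  rw [hv', hv, ← h7, h3 _ (by omega)]

/-- The next sector may vary along an approximating family, but the closure of a finite union is the
union of the closures, so one `j` serves the limit. -/
theorem exists_derived_mem_closure {i : Fin 8} {w : Word} (hw : w ∈ closure (InSector i)) :
    ∃ j : Fin 8, j ≠ 0 ∧ IsPath (relabel i w) ∧ SandwichedInGroup (quarter j) (relabel i w) ∧
      ∃ v, IsDerived (relabel i w) v ∧ v ∈ closure (InSector j) := by
  have h1 : relabel i w ∈ closure (⋃ j : {j : Fin 8 // j ≠ 0}, {u : Word | IsPath u ∧
      SandwichedInGroup (quarter j) u ∧ ∀ v, IsDerived u v → v ∈ InSector j}) := by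
    rw [mem_closure_iff_windows] at hw ⊢
    intro N
    obtain ⟨v, hv, hv'⟩ := hw N
    obtain ⟨j, hj, h⟩ := derive_mem_inSector (inSector_iff.1 hv)
    refine ⟨relabel i v, Set.mem_iUnion.2 ⟨⟨j, hj⟩, h⟩, fun n hn => ?_⟩
    simp only [relabel, hv' n hn]
  rw [closure_iUnion_of_finite, Set.mem_iUnion] at h1
  obtain ⟨⟨j, hj⟩, h⟩ := h1
  exact ⟨j, hj, derive_mem_closure h⟩

theorem exists_coherentTower {i : Fin 8} {w : Word} (hw : w ∈ closure (InSector i)) :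
    ∃ s W, s 0 = i ∧ W 0 = w ∧ IsCoherentTower s W := by
  let X := {p : Fin 8 × Word // p.2 ∈ closure (InSector p.1)}
  have hstep : ∀ p : X, ∃ q : X, q.1.1 ≠ 0 ∧ IsPath (relabel p.1.1 p.1.2) ∧
      SandwichedInGroup (quarter q.1.1) (relabel p.1.1 p.1.2) ∧
      IsDerived (relabel p.1.1 p.1.2) q.1.2 := by
    intro p
    obtain ⟨j, h1, h2, h3, v, h4, h5⟩ := exists_derived_mem_closure p.2
    exact ⟨⟨(j, v), h5⟩, h1, h2, h3, h4⟩
  choose f hf using hstep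
  let p : ℕ → X := fun k => f^[k] ⟨(i, w), hw⟩
  refine ⟨fun k => (p k).1.1, fun k => (p k).1.2, rfl, rfl, fun k => ?_⟩
  have hp : p (k + 1) = f (p k) := Function.iterate_succ_apply' _ _ _
  simp only [hp]
  exact hf (p k)

/-! ### Coherent towers and infinitely coherent words -/

theorem sandwiched_relabel (j : Fin 8) (w : Word) (n : ℤ) :
    Sandwiched (relabel j w) n ↔ Sandwiched w n :=
  (perm_injective j).eq_iff

theorem IsDerived.relabel {w v : Word} (h : IsDerived w v) (j : Fin 8) :
    IsDerived (relabel j w) (relabel j v) := by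
  obtain ⟨e, he, hr, hv⟩ := h
  refine ⟨e, he, ?_, fun n => congrArg _ (hv n)⟩
  rw [hr]
  ext n
  exact (sandwiched_relabel j w n).symm

theorem admissible_relabel {w : Word} (h : Admissible w) (j : Fin 8) :
    Admissible (relabel j w) := by
  obtain ⟨i, hi⟩ := h
  obtain ⟨j', hj', -⟩ := exists_perm_inverse j
  obtain ⟨l, hl⟩ := exists_perm_mul i j'
  refine ⟨l, fun n => ?_⟩
  have : ∀ n, perm l (OctagonCutting.relabel j w n) = perm i (w n) := fun n => by
    rw [hl]
    exact congrArg _ (hj' _)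
  rw [Edge, this, this]
  exact hi n

theorem IsCoherentTower.infinitelyCoherent {s : ℕ → Fin 8} {W : ℕ → Word}
    (h : IsCoherentTower s W) : InfinitelyCoherent (W 0) := by
  have hadm : ∀ k, AdmissibleIn (s k) (W k) := fun k => (h k).2.1
  choose inv hinv _ using exists_perm_inverse
  choose mul hmul using exists_perm_mul
  have hinv' : ∀ j w, relabel (inv j) (relabel j w) = w := fun j w => funext fun n => hinv _ _
  have hmul' : ∀ i j w, relabel (mul i j) w = relabel i (relabel j w) :=
    fun i j w => funext fun n => hmul _ _ _
  have hder : ∀ k, IsDerived (W k) (relabel (inv (s k)) (W (k + 1))) := fun k => by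
    have := (h k).2.2.2.relabel (inv (s k))
    rwa [hinv'] at this
  have hderivable : ∀ k, Derivable (W k) := fun k =>
    ⟨⟨_, hadm k⟩, _, hder k, admissible_relabel ⟨_, hadm (k + 1)⟩ _⟩
  -- The accumulated permutation undoes all the relabellings: the plain iterated derived words of `W
  -- 0` are the `relabel (τ k) (W k)`.
  let τ : ℕ → Fin 8 := fun k => Nat.rec 0 (fun k j => mul j (inv (s k))) k
  have hτ : ∀ k, IsDerived (relabel (τ k) (W k)) (relabel (τ (k + 1)) (W (k + 1))) := fun k => by
    have := (hder k).relabel (τ k)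
    rwa [← hmul'] at this
  refine ⟨s, fun k hk => ?_, ⟨fun k => relabel (τ k) (W k), relabel_zero _, hτ, fun k => ?_⟩, W,
    ⟨rfl, fun k => (h k).2.2.2⟩, fun k => ?_⟩
  · cases k with
    | zero => rfl
    | succ k => exact absurd hk (h k).1
  · exact ⟨admissible_relabel ⟨_, hadm k⟩ _, _, hτ k, admissible_relabel ⟨_, hadm (k + 1)⟩ _⟩
  · exact ⟨hderivable k, hadm k, quarter (s (k + 1)), (h k).2.2.1,
      ⟨(h k).1, _, (h k).2.2.2, hadm (k + 1)⟩, quarter_val _⟩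

theorem InfinitelyCoherent.exists_tower {w : Word} (h : InfinitelyCoherent w) :
    ∃ s W, W 0 = w ∧ IsCoherentTower s W := by
  obtain ⟨s, hs, -, W, ⟨hW0, hW⟩, hcoh⟩ := h
  refine ⟨s, W, hW0, fun k => ?_⟩
  obtain ⟨-, h1, k', h2, ⟨h3, -⟩, h4⟩ := hcoh k
  obtain rfl : k' = quarter (s (k + 1)) := Fin.ext (h4.trans (quarter_val _).symm)
  exact ⟨h3, h1, h2, hW k⟩

theorem closure_inSector_eq : closure (⋃ j, InSector j) = {w | InfinitelyCoherent w} := by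
  ext w
  constructor
  · intro hw
    rw [closure_iUnion_of_finite, Set.mem_iUnion] at hw
    obtain ⟨i, hi⟩ := hw
    obtain ⟨s, W, -, rfl, h⟩ := exists_coherentTower hi
    exact h.infinitelyCoherent
  · intro hw
    obtain ⟨s, W, rfl, h⟩ := InfinitelyCoherent.exists_tower hw
    rw [mem_closure_iff_windows]
    intro N
    obtain ⟨v, hv, hv'⟩ := h.exists_window (2 * N) (-N)
    refine ⟨v, Set.mem_iUnion.2 ⟨_, hv⟩, fun n hn => ?_⟩
    have := hv' (n + N).toNat (by omega)
    rwa [show -(N : ℤ) + ((n + N).toNat : ℤ) = n by omega] at this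

/-! ### Geometry of the octagon -/

/-- The outward unit normal of a side of the octagon. -/
noncomputable def normal : Fin 8 → ℝ × ℝ :=
  ![(0, 1), (√2 / 2, √2 / 2), (1, 0), (√2 / 2, -(√2 / 2)),
    (0, -1), (-(√2 / 2), -(√2 / 2)), (-1, 0), (-(√2 / 2), √2 / 2)]

/-- The scalar product of the plane. -/
def dot (p q : ℝ × ℝ) : ℝ := p.1 * q.1 + p.2 * q.2

/-- The determinant of two vectors of the plane. -/
def det (p q : ℝ × ℝ) : ℝ := p.1 * q.2 - p.2 * q.1

/-- The rotation by a right angle. -/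
def quarterTurn (p : ℝ × ℝ) : ℝ × ℝ := (-p.2, p.1)

theorem dot_self_normal (k : Fin 8) : dot (normal k) (normal k) = 1 := by
  have h := sqrt_two_mul_self
  fin_cases k <;> simp [dot, normal] <;> linarith

theorem vertex_eq (k : Fin 8) :
    vertex k = (silver / 2) • normal k + (1 / 2 : ℝ) • quarterTurn (normal k) := by
  have h := sqrt_two_mul_self
  fin_cases k <;> ext <;> simp [vertex, normal, quarterTurn, halfWidth, silver] <;> linarith

theorem vertex_succ_eq (k : Fin 8) :
    vertex (k + 1) = (silver / 2) • normal k - (1 / 2 : ℝ) • quarterTurn (normal k) := by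
  have h := sqrt_two_mul_self
  fin_cases k <;> ext <;> simp [vertex, normal, quarterTurn, halfWidth, silver] <;> linarith

theorem glueVector_eq (k : Fin 8) : glueVector k = -(silver • normal k) := by
  have h := sqrt_two_mul_self
  fin_cases k <;> ext <;> simp [glueVector, vertex, normal, halfWidth, silver] <;> linarith

theorem normal_add_four (k : Fin 8) : normal (k + 4) = -normal k := by
  fin_cases k <;> simp [normal]

theorem sideLabel_add_four (k : Fin 8) : sideLabel (k + 4) = sideLabel k := by
  fin_cases k <;> rfl

theorem mem_openSide_iff (k : Fin 8) (p : ℝ × ℝ) :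
    p ∈ openSide k ↔ ∃ σ : ℝ, |σ| < 1 / 2 ∧
      p = (silver / 2) • normal k + σ • quarterTurn (normal k) := by
  rw [openSide, vertex_eq, vertex_succ_eq]
  constructor
  · rintro ⟨α, β, hα, hβ, hαβ, rfl⟩
    refine ⟨(α - β) / 2, by rw [abs_lt]; constructor <;> linarith, ?_⟩
    obtain rfl : β = 1 - α := by linarith
    module
  · rintro ⟨σ, hσ, rfl⟩
    rw [abs_lt] at hσ
    refine ⟨1 / 2 + σ, 1 / 2 - σ, by linarith, by linarith, by ring, ?_⟩
    module

theorem dot_normal_vertex (j i : Fin 8) :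
    dot (normal j) (vertex i) ≤ silver / 2 ∧
      (j ≠ i → j + 1 ≠ i → dot (normal j) (vertex i) < silver / 2) := by
  have h := sqrt_two_mul_self
  obtain ⟨h1, h2⟩ := sqrt_two_bounds
  fin_cases j <;> fin_cases i <;> simp [dot, normal, vertex, halfWidth, silver] <;>
    first | linarith | (constructor <;> linarith)

theorem dot_normal_le {p : ℝ × ℝ} (hp : p ∈ octagon) (j : Fin 8) :
    dot (normal j) p ≤ silver / 2 := by
  have hconv : Convex ℝ {p : ℝ × ℝ | dot (normal j) p ≤ silver / 2} := by
    intro p hp q hq α β hα hβ hαβ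
    change dot _ _ ≤ _ at hp hq
    change dot _ _ ≤ _
    obtain rfl : β = 1 - α := by linarith
    simp only [dot, Prod.fst_add, Prod.snd_add, Prod.smul_fst, Prod.smul_snd, smul_eq_mul] at *
    nlinarith
  refine convexHull_min ?_ hconv hp
  rintro _ ⟨i, rfl⟩
  exact (dot_normal_vertex j i).1

theorem dot_normal_lt_of_mem_interior {p : ℝ × ℝ} (hp : p ∈ interior octagon) (j : Fin 8) :
    dot (normal j) p < silver / 2 := by
  have hcont : Filter.Tendsto (fun ε : ℝ => p + ε • normal j) (nhds 0) (nhds p) := by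
    have : Continuous fun ε : ℝ => p + ε • normal j := by fun_prop
    simpa using this.tendsto 0
  have h1 := hcont.eventually (mem_interior_iff_mem_nhds.1 hp)
  obtain ⟨ε, h2, h3⟩ :=
    ((h1.filter_mono nhdsWithin_le_nhds).and (self_mem_nhdsWithin (s := Set.Ioi (0 : ℝ)))).exists
  have h4 := dot_normal_le h2 j
  have h5 := dot_self_normal j
  have h6 : (0 : ℝ) < ε := h3
  simp only [dot, Prod.fst_add, Prod.snd_add, Prod.smul_fst, Prod.smul_snd, smul_eq_mul] at *
  nlinarith

theorem mem_of_horizontal {S : Set (ℝ × ℝ)} (hS : Convex ℝ S) {x y X : ℝ} (h1 : (-X, y) ∈ S)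
    (h2 : (X, y) ∈ S) (hX : 0 < X) (hx : |x| ≤ X) : (x, y) ∈ S := by
  rw [abs_le] at hx
  have h := hS h1 h2 (a := (X - x) / (2 * X)) (b := (X + x) / (2 * X))
    (div_nonneg (by linarith) (by linarith)) (div_nonneg (by linarith) (by linarith))
    (by field_simp; ring)
  convert h using 1
  ext <;> simp <;> field_simp <;> ring

/-- Horizontal lines cut the octagon into two trapezoids and a rectangle. At the height of `p`, the
point lies on a horizontal chord of half-length `X`, whose end points are explicit convex
combinations of vertices. -/
theorem mem_octagon {p : ℝ × ℝ} (hp : ∀ j, dot (normal j) p < silver / 2) : p ∈ octagon := by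
  have hconv : Convex ℝ octagon := convex_convexHull ℝ _
  have hv : ∀ i, vertex i ∈ octagon := fun i => subset_convexHull ℝ _ ⟨i, rfl⟩
  have hs := sqrt_two_mul_self
  obtain ⟨hs1, hs2⟩ := sqrt_two_bounds
  obtain ⟨x, y⟩ := p
  have e2 : √2 * (√2 * y) = 2 * y := by rw [← mul_assoc, hs]
  have p0 := hp 0
  have p1 := hp 1
  have p2 := hp 2
  have p3 := hp 3
  have p4 := hp 4
  have p5 := hp 5
  have p6 := hp 6
  have p7 := hp 7
  simp [dot, normal, silver] at p0 p1 p2 p3 p4 p5 p6 p7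
  have key : ∀ i j : Fin 8, ∀ s : ℝ, 0 ≤ s → s ≤ 1 → ∀ q, q = s • vertex i + (1 - s) • vertex j →
      q ∈ octagon := by
    rintro i j s h1 h2 q rfl
    exact hconv (hv i) (hv j) h1 (by linarith) (by ring)
  have hscale : ∀ z : ℝ, √2 / 2 * z < (1 + √2) / 2 → z < 1 + √2 / 2 := fun z hz => by
    nlinarith
  have q1 := hscale (x + y) (by linarith)
  have q3 := hscale (x - y) (by linarith)
  have q5 := hscale (-x - y) (by linarith)
  have q7 := hscale (-x + y) (by linarith)
  by_cases h1 : 1 / 2 < y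
  · refine mem_of_horizontal hconv (X := 1 + √2 / 2 - y)
      (key 0 7 (√2 * (y - 1 / 2)) ?_ ?_ _ ?_) (key 1 2 (√2 * (y - 1 / 2)) ?_ ?_ _ ?_) ?_ ?_
    · exact mul_nonneg (by linarith) (by linarith)
    · nlinarith
    · ext <;> simp [vertex, halfWidth] <;> linarith
    · exact mul_nonneg (by linarith) (by linarith)
    · nlinarith
    · ext <;> simp [vertex, halfWidth] <;> linarith
    · linarith
    · rw [abs_le]
      constructor <;> linarith
  push Not at h1
  by_cases h2 : y < -(1 / 2)
  · refine mem_of_horizontal hconv (X := 1 + √2 / 2 + y)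
      (key 5 6 (√2 * (-y - 1 / 2)) ?_ ?_ _ ?_) (key 4 3 (√2 * (-y - 1 / 2)) ?_ ?_ _ ?_) ?_ ?_
    · exact mul_nonneg (by linarith) (by linarith)
    · nlinarith
    · ext <;> simp [vertex, halfWidth] <;> linarith
    · exact mul_nonneg (by linarith) (by linarith)
    · nlinarith
    · ext <;> simp [vertex, halfWidth] <;> linarith
    · linarith
    · rw [abs_le]
      constructor <;> linarith
  push Not at h2
  refine mem_of_horizontal hconv (X := halfWidth)
    (key 7 6 (y + 1 / 2) ?_ ?_ _ ?_) (key 2 3 (y + 1 / 2) ?_ ?_ _ ?_) ?_ ?_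
  · linarith
  · linarith
  · ext <;> simp [vertex] <;> linarith
  · linarith
  · linarith
  · ext <;> simp [vertex] <;> linarith
  · unfold halfWidth
    linarith
  · unfold halfWidth
    rw [abs_le]
    constructor <;> linarith

theorem mem_interior_octagon {p : ℝ × ℝ} (hp : ∀ j, dot (normal j) p < silver / 2) :
    p ∈ interior octagon := by
  have hopen : IsOpen {p : ℝ × ℝ | ∀ j, dot (normal j) p < silver / 2} := by
    simp only [Set.ofPred_forall]
    refine isOpen_iInter_of_finite fun j => isOpen_lt ?_ continuous_const
    unfold dot
    fun_prop
  exact interior_maximal (fun p hp => mem_octagon hp) hopen hp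

theorem dot_normal_openSide {j k : Fin 8} {p : ℝ × ℝ} (hp : p ∈ openSide k) :
    (j = k → dot (normal j) p = silver / 2) ∧ (j ≠ k → dot (normal j) p < silver / 2) := by
  constructor
  · rintro rfl
    obtain ⟨σ, -, rfl⟩ := (mem_openSide_iff j p).1 hp
    have h := dot_self_normal j
    simp only [dot, quarterTurn, Prod.fst_add, Prod.snd_add, Prod.smul_fst, Prod.smul_snd,
      smul_eq_mul] at *
    linear_combination silver / 2 * h
  · intro hjk
    obtain ⟨α, β, hα, hβ, hαβ, rfl⟩ := hp
    have h1 := dot_normal_vertex j k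
    have h2 := dot_normal_vertex j (k + 1)
    have h3 : dot (normal j) (α • vertex k + β • vertex (k + 1)) =
        α * dot (normal j) (vertex k) + β * dot (normal j) (vertex (k + 1)) := by
      simp only [dot, Prod.fst_add, Prod.snd_add, Prod.smul_fst, Prod.smul_snd, smul_eq_mul]
      ring
    rw [h3]
    obtain rfl : β = 1 - α := by linarith
    have h4 : j + 1 ≠ k + 1 := fun h => hjk (add_right_cancel h)
    by_cases h5 : j + 1 = k
    · have h6 : j ≠ k + 1 := by
        subst h5
        have : ∀ j : Fin 8, j ≠ j + 1 + 1 := by decide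
        exact this j
      have := h2.2 h6 h4
      nlinarith [h1.1]
    · have := h1.2 hjk h5
      nlinarith [h2.1]

/-! ### Trajectories and codings -/

/-- The sides `k n` are crossed by a trajectory with direction `u`; the height of the point of the
side relatively to its midpoint is `t n / 2`. -/
def IsSideCoding (u : ℝ × ℝ) (k : ℤ → Fin 8) (t : ℤ → ℝ) : Prop :=
  ∀ n, |t n| < dot (normal (k n)) u ∧
    t (n + 1) = t n - silver * det u (normal (k n)) - silver * det u (normal (k (n + 1)))

theorem IsSideCoding.neg {u : ℝ × ℝ} {k : ℤ → Fin 8} {t : ℤ → ℝ} (h : IsSideCoding u k t) :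
    IsSideCoding (-u) (fun n => k n + 4) t := by
  intro n
  have h1 := h n
  simp only [normal_add_four]
  simpa [dot, det, sub_eq_add_neg] using h1

theorem dot_pos_of_exit {u p : ℝ × ℝ} {s : ℝ} {k : Fin 8} (hs : 0 < s)
    (h1 : p + s • u ∈ openSide k) (h2 : openSegment ℝ p (p + s • u) ⊆ interior octagon) :
    0 < dot (normal k) u := by
  have h3 := (dot_normal_openSide (j := k) h1).1 rfl
  have h4 : p + (s / 2) • u ∈ openSegment ℝ p (p + s • u) :=
    ⟨1 / 2, 1 / 2, by norm_num, by norm_num, by norm_num, by module⟩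
  have h5 := dot_normal_lt_of_mem_interior (h2 h4) k
  simp only [dot, Prod.fst_add, Prod.snd_add, Prod.smul_fst, Prod.smul_snd, smul_eq_mul] at *
  by_contra hcon
  push Not at hcon
  nlinarith

/-- The determinant with the direction is constant along a chord, and gluing translates it by a
multiple of the determinant with the normal. -/
theorem LinearTrajectory.exists_isSideCoding (τ : LinearTrajectory) :
    ∃ t, IsSideCoding (direction τ.θ) τ.side t := by
  set u := direction τ.θ with hu
  refine ⟨fun n => 2 * det u (τ.entry n + τ.time n • u) - silver * det u (normal (τ.side n)),
    fun n => ⟨?_, ?_⟩⟩ <;> beta_reduce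
  · have h1 := dot_pos_of_exit (τ.time_pos n) (τ.exit_mem n) (τ.chord_subset n)
    obtain ⟨σ, h2, h3⟩ := (mem_openSide_iff _ _).1 (τ.exit_mem n)
    rw [← hu] at h1 h3
    have h4 : 2 * det u (τ.entry n + τ.time n • u) - silver * det u (normal (τ.side n)) =
        2 * σ * dot (normal (τ.side n)) u := by
      rw [h3]
      simp only [det, dot, quarterTurn, Prod.fst_add, Prod.snd_add, Prod.smul_fst, Prod.smul_snd,
        smul_eq_mul]
      ring
    rw [h4, abs_mul, abs_of_pos h1, abs_mul, abs_of_pos (by norm_num : (0 : ℝ) < 2)]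
    nlinarith
  · have h1 := τ.entry_succ n
    rw [glueVector_eq, ← hu] at h1
    rw [h1]
    simp only [det, Prod.fst_add, Prod.snd_add, Prod.smul_fst, Prod.smul_snd, Prod.fst_neg,
      Prod.snd_neg, smul_eq_mul]
    ring

/-- The height fixes the exit point on its side, and the preceding exit fixes the entry. The
recurrence for `t` says exactly that the vector from entry to exit is parallel to the direction. -/
theorem IsSideCoding.exists_trajectory {θ : ℝ} {k : ℤ → Fin 8} {t : ℤ → ℝ}
    (h : IsSideCoding (direction θ) k t) : ∃ τ : LinearTrajectory, τ.side = k := by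
  have hunit : dot (direction θ) (direction θ) = 1 := by
    simp only [dot, direction]
    nlinarith [Real.sin_sq_add_cos_sq θ]
  set u := direction θ with hu
  have hpos : ∀ n, 0 < dot (normal (k n)) u := fun n => (abs_nonneg _).trans_lt (h n).1
  let exit : ℤ → ℝ × ℝ := fun n => (silver / 2) • normal (k n) +
    (t n / (2 * dot (normal (k n)) u)) • quarterTurn (normal (k n))
  let entry : ℤ → ℝ × ℝ := fun n => exit (n - 1) + glueVector (k (n - 1))
  let time : ℤ → ℝ := fun n => dot u (exit n - entry n)
  have hexit : ∀ n, exit n ∈ openSide (k n) := fun n => by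
    rw [mem_openSide_iff]
    refine ⟨_, ?_, rfl⟩
    have := hpos n
    rw [abs_div, abs_of_pos (by linarith : 0 < 2 * dot (normal (k n)) u), div_lt_iff₀ (by linarith)]
    linarith [(h n).1]
  have hentry : ∀ n, entry n ∈ openSide (k (n - 1) + 4) := fun n => by
    obtain ⟨σ, h1, h2⟩ := (mem_openSide_iff _ _).1 (hexit (n - 1))
    rw [mem_openSide_iff]
    refine ⟨-σ, by rwa [abs_neg], ?_⟩
    simp only [entry]
    rw [h2, glueVector_eq, normal_add_four]
    ext <;> simp [quarterTurn] <;> ring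
  have hheight : ∀ n, 2 * det u (exit n) = silver * det u (normal (k n)) + t n := fun n => by
    have h1 : t n / (2 * dot (normal (k n)) u) * (2 * dot (normal (k n)) u) = t n :=
      div_mul_cancel₀ _ (by linarith [hpos n])
    simp only [exit]
    generalize t n / (2 * dot (normal (k n)) u) = σ at h1 ⊢
    rw [← h1]
    simp only [det, dot, quarterTurn, Prod.fst_add, Prod.snd_add, Prod.smul_fst, Prod.smul_snd,
      smul_eq_mul]
    ring
  have hparallel : ∀ n, det u (exit n - entry n) = 0 := fun n => by
    have h1 := hheight n
    have h2 := hheight (n - 1)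
    have h3 := (h (n - 1)).2
    rw [sub_add_cancel] at h3
    have h4 : det u (exit n - entry n) =
        det u (exit n) - det u (exit (n - 1)) + silver * det u (normal (k (n - 1))) := by
      simp only [entry, glueVector_eq]
      simp only [det, Prod.fst_add, Prod.snd_add, Prod.fst_sub, Prod.snd_sub, Prod.smul_fst,
        Prod.smul_snd, Prod.fst_neg, Prod.snd_neg, smul_eq_mul]
      ring
    linarith
  have htime : ∀ n, entry n + time n • u = exit n := fun n => by
    have h1 := hparallel n
    have h2 : time n • u = exit n - entry n := by
      simp only [time]
      generalize exit n - entry n = q at h1 ⊢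
      simp only [det, dot] at *
      ext <;> simp only [Prod.smul_fst, Prod.smul_snd, smul_eq_mul]
      · linear_combination q.1 * hunit + u.2 * h1
      · linear_combination q.2 * hunit - u.1 * h1
    rw [h2]
    abel
  -- The direction points inward across the entry side and outward across the exit side. Since these
  -- sides differ, no supporting inequality is an equality at both ends of the chord.
  have hne : ∀ n, k n ≠ k (n - 1) + 4 := fun n heq => by
    have h1 := hpos n
    have h2 := hpos (n - 1)
    rw [heq, normal_add_four] at h1
    simp only [dot, Prod.fst_neg, Prod.snd_neg] at h1 h2
    linarith
  refine ⟨⟨θ, entry, time, k, fun n => ?_, fun n => ?_, fun n => ?_, fun n => ?_⟩, rfl⟩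
  · have h1 := (dot_normal_openSide (j := k n) (hexit n)).1 rfl
    have h2 := (dot_normal_openSide (j := k n) (hentry n)).2 (hne n)
    rw [← htime n] at h1
    have h3 := hpos n
    have h4 : dot (normal (k n)) (entry n + time n • u) =
        dot (normal (k n)) (entry n) + time n * dot (normal (k n)) u := by
      simp only [dot, Prod.fst_add, Prod.snd_add, Prod.smul_fst, Prod.smul_snd, smul_eq_mul]
      ring
    by_contra hcon
    push Not at hcon
    nlinarith
  · rw [← hu, htime]
    exact hexit n
  · rw [← hu, htime]
    rintro _ ⟨α, β, hα, hβ, hαβ, rfl⟩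
    refine mem_interior_octagon fun j => ?_
    have h1 : dot (normal j) (α • entry n + β • exit n) =
        α * dot (normal j) (entry n) + β * dot (normal j) (exit n) := by
      simp only [dot, Prod.fst_add, Prod.snd_add, Prod.smul_fst, Prod.smul_snd, smul_eq_mul]
      ring
    rw [h1]
    have h2 := dot_normal_openSide (j := j) (hentry n)
    have h3 := dot_normal_openSide (j := j) (hexit n)
    obtain rfl : β = 1 - α := by linarith
    by_cases h4 : j = k n
    · have h5 := h2.2 fun h5 => hne n (h4.symm.trans h5)
      have h6 := h3.1 h4
      nlinarith
    · have h6 := h3.2 h4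
      by_cases h7 : j = k (n - 1) + 4
      · have h8 := h2.1 h7
        nlinarith
      · have h8 := h2.2 h7
        nlinarith
  · change exit (n + 1 - 1) + glueVector (k (n + 1 - 1)) = _
    rw [← hu, htime, add_sub_cancel_right]

theorem dot_normal_eq_radius {q : Fin 4} {x y : ℝ} (hr : ∀ L, 0 ≤ radius q x y L) {k : Fin 8}
    (hk : 0 < dot (normal k) (x, y)) :
    dot (normal k) (x, y) = radius q x y (sideLabel k) ∧
      silver * det (x, y) (normal k) = center q x y (sideLabel k) := by
  have h := hr (sideLabel k)
  have key : (dot (normal k) (x, y) = normalDot x y (sideLabel k) ∧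
        det (x, y) (normal k) = normalCross x y (sideLabel k)) ∨
      (dot (normal k) (x, y) = -normalDot x y (sideLabel k) ∧
        det (x, y) (normal k) = -normalCross x y (sideLabel k)) := by
    fin_cases k
    iterate 4
      left
      constructor <;> simp [dot, det, normal, sideLabel, normalDot, normalCross] <;> ring
    all_goals
      right
      constructor <;> simp [dot, det, normal, sideLabel, normalDot, normalCross] <;> ring
  have hsign : exitSign q (sideLabel k) = 1 ∨ exitSign q (sideLabel k) = -1 := by
    cases sideLabel k <;> simp only [exitSign] <;> (try split_ifs) <;> simp
  simp only [radius, center] at h ⊢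
  rcases key with ⟨h1, h2⟩ | ⟨h1, h2⟩ <;> rcases hsign with h3 | h3 <;> rw [h3] at h ⊢ <;>
    rw [h1] at hk ⊢ <;> rw [h2] <;> first
    | (exfalso; linarith)
    | (constructor <;> ring)

theorem exists_normal_of_radius_pos {q : Fin 4} {x y : ℝ} {L : Letter} (h : 0 < radius q x y L) :
    ∃ k, sideLabel k = L ∧ 0 < dot (normal k) (x, y) := by
  obtain ⟨k, hk, h1⟩ : ∃ k, sideLabel k = L ∧ dot (normal k) (x, y) = normalDot x y L := by
    cases L
    · exact ⟨0, rfl, by simp [dot, normal, normalDot]⟩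
    · exact ⟨1, rfl, by simp [dot, normal, normalDot]; ring⟩
    · exact ⟨2, rfl, by simp [dot, normal, normalDot]⟩
    · exact ⟨3, rfl, by simp [dot, normal, normalDot]; ring⟩
  rcases lt_trichotomy 0 (normalDot x y L) with h2 | h2 | h2
  · exact ⟨k, hk, by rwa [h1]⟩
  · rw [radius, ← h2, mul_zero] at h
    exact absurd h (lt_irrefl _)
  · refine ⟨k + 4, by rw [sideLabel_add_four, hk], ?_⟩
    rw [normal_add_four]
    simp only [dot, Prod.fst_neg, Prod.snd_neg] at h1 ⊢
    linarith

theorem exists_sector_of_nonneg {u : ℝ × ℝ} (hu : 0 ≤ u.2) (hu' : u ≠ 0) :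
    ∃ j c a, BaseSector c a ∧ u = (sectorX j c a, sectorY j c a) := by
  obtain ⟨x, y⟩ := u
  rcases le_total x (silver * y) with h | h
  · obtain ⟨j, -, c, a, h1, h2, h3⟩ := exists_sector hu (x := x) (by
      by_contra! hcon
      exact hu' (Prod.ext hcon.1 hcon.2)) h
    exact ⟨j, c, a, h1, by rw [← h2, ← h3]⟩
  · refine ⟨0, x, y, ⟨hu, h, ?_⟩, rfl⟩
    have hs := silver_bounds
    have hu2 : 0 ≤ y := hu
    have h1 : 0 ≤ x := le_trans (mul_nonneg (by linarith) hu2) h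
    refine lt_of_le_of_ne h1 fun h0 => hu' ?_
    have : y = 0 := by nlinarith
    rw [← h0, this]
    rfl

theorem IsSideCoding.mem_inSector {u : ℝ × ℝ} {k : ℤ → Fin 8} {t : ℤ → ℝ}
    (h : IsSideCoding u k t) : ∃ j, (fun n => sideLabel (k n)) ∈ InSector j := by
  -- The half-turn about the centre exchanges opposite sides, so it preserves the labels and the
  -- heights.
  wlog hu : 0 ≤ u.2 generalizing u k
  · have h1 := this h.neg (by simp only [Prod.snd_neg]; linarith)
    simpa only [sideLabel_add_four] using h1
  have hu' : u ≠ 0 := by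
    rintro rfl
    have h1 := (h 0).1
    have h2 := abs_nonneg (t 0)
    simp [dot] at h1
    linarith
  obtain ⟨j, c, a, hb, rfl⟩ := exists_sector_of_nonneg hu hu'
  refine ⟨j, c, a, hb, ?_⟩
  rw [← isCoding_sector_iff]
  have hr := radius_sector_nonneg hb j
  have hpos : ∀ n, 0 < dot (normal (k n)) (sectorX j c a, sectorY j c a) :=
    fun n => (abs_nonneg _).trans_lt (h n).1
  refine ⟨t, fun n => ?_⟩
  have h1 := h n
  rwa [(dot_normal_eq_radius hr (hpos n)).2, (dot_normal_eq_radius hr (hpos (n + 1))).2,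
    (dot_normal_eq_radius hr (hpos n)).1] at h1

theorem exists_direction {x y : ℝ} (h : x ≠ 0 ∨ y ≠ 0) :
    ∃ θ l : ℝ, 0 < l ∧ direction θ = (l * x, l * y) := by
  have hz : (⟨x, y⟩ : ℂ) ≠ 0 := by
    intro h0
    have h1 := congrArg Complex.re h0
    have h2 := congrArg Complex.im h0
    simp only [Complex.zero_re, Complex.zero_im] at h1 h2
    rcases h with h | h
    · exact h h1
    · exact h h2
  refine ⟨Complex.arg ⟨x, y⟩, ‖(⟨x, y⟩ : ℂ)‖⁻¹, by positivity, ?_⟩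
  rw [direction, Complex.cos_arg hz, Complex.sin_arg, div_eq_inv_mul, div_eq_inv_mul]

theorem exists_trajectory_of_mem_inSector {j : Fin 8} {w : Word} (hw : w ∈ InSector j) :
    ∃ τ : LinearTrajectory, τ.cuttingSequence = w := by
  obtain ⟨c, a, hb, hc⟩ := hw
  rw [← isCoding_sector_iff] at hc
  have hr := radius_sector_nonneg hb j
  have hne : sectorX j c a ≠ 0 ∨ sectorY j c a ≠ 0 := by
    by_contra! hcon
    obtain ⟨t, ht⟩ := hc
    have h1 := (ht 0).1
    have h2 := abs_nonneg (t 0)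
    rw [hcon.1, hcon.2, radius] at h1
    have h3 : ∀ L, normalDot 0 0 L = 0 := fun L => by cases L <;> simp [normalDot]
    rw [h3] at h1
    linarith
  obtain ⟨θ, l, hl, hθ⟩ := exists_direction hne
  have hc' := hc.smul hl
  set x := sectorX j c a
  set y := sectorY j c a
  have hdot : ∀ L, normalDot (l * x) (l * y) L = l * normalDot x y L := fun L => by
    cases L <;> simp only [normalDot] <;> ring
  have hcross : ∀ L, normalCross (l * x) (l * y) L = l * normalCross x y L := fun L => by
    cases L <;> simp only [normalCross] <;> ring
  have h1 : ∀ L, l * radius (quarter j) x y L = radius (quarter j) (l * x) (l * y) L := fun L => by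
    simp only [radius, hdot]
    ring
  have h2 : ∀ L, l * center (quarter j) x y L = center (quarter j) (l * x) (l * y) L := fun L => by
    simp only [center, hcross]
    ring
  have hr' : ∀ L, 0 ≤ radius (quarter j) (l * x) (l * y) L := fun L => by
    rw [← h1]
    exact mul_nonneg hl.le (hr L)
  obtain ⟨t, ht⟩ := hc'
  simp only [h1, h2] at ht
  have hk : ∀ n, ∃ k, sideLabel k = w n ∧ 0 < dot (normal k) (l * x, l * y) := fun n =>
    exists_normal_of_radius_pos ((abs_nonneg _).trans_lt (ht n).1)
  choose k hk1 hk2 using hk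
  have hside : IsSideCoding (direction θ) k t := by
    intro n
    rw [hθ, (dot_normal_eq_radius hr' (hk2 n)).1, (dot_normal_eq_radius hr' (hk2 n)).2,
      (dot_normal_eq_radius hr' (hk2 (n + 1))).2, hk1, hk1]
    exact ht n
  obtain ⟨τ, hτ⟩ := hside.exists_trajectory
  refine ⟨τ, funext fun n => ?_⟩
  rw [LinearTrajectory.cuttingSequence, hτ, hk1]

theorem range_cuttingSequence : Set.range LinearTrajectory.cuttingSequence = ⋃ j, InSector j := by
  ext w
  rw [Set.mem_iUnion]
  constructor
  · rintro ⟨τ, rfl⟩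
    obtain ⟨t, ht⟩ := τ.exists_isSideCoding
    exact ht.mem_inSector
  · rintro ⟨j, hj⟩
    exact exists_trajectory_of_mem_inSector hj

end OctagonCutting

theorem theorem2p12 :
    closure (Set.range OctagonCutting.LinearTrajectory.cuttingSequence) =
      {w : OctagonCutting.Word | OctagonCutting.InfinitelyCoherent w} := by
  rw [OctagonCutting.range_cuttingSequence]
  exact OctagonCutting.closure_inSector_eq
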